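/- **Model.** Let $\mathbb K$ be a commutative ring. Algorithms are programs of an algebraic random access machine. A register contains either an element of $\mathbb K$ or a pointer (a natural number that is $O(n)$ in size $n$). One program serves all sizes $n$; branching and addressing depend on pointers only, not on elements of $\mathbb K$. The time is the number of operations $+,-,\times,\div$ (by units) in $\mathbb K$. The input registers are read-only unless stated otherwise; the output registers are preallocated and may be read and written. The extra space is the number of all further registers (those for pointers included); these, like the output registers, have arbitrary initial contents. The short product of two polynomials $F,G\in\mathbb K[X]$ of size $n$ (that is, of degree $<n$) is $FG \bmod X^n$. The middle product of $F$ of size $2n-1$ and $G$ of size $n$ is $(FG \,\mathrm{div}\, X^{n-1}) \bmod X^n$. **Statement.** Let $\mathsf M:\mathbb N\to\mathbb R$ satisfy $\alpha\,\mathsf M(n)\le \mathsf M(\alpha n)$ for all integers $n\ge1$ and all real $\alpha\ge 1$ with $\alpha n\in\mathbb N$. Let $\lambda_m,\lambda_s\ge 1$ and $c_m,c_s\ge 0$ be real constants, and suppose that, for all $n\ge1$, - some algorithm computes middle products in size $(2n-1,n)$ with at most $\lambda_m\mathsf M(n)$ operations in $\mathbb K$ and at most $c_m n+O(1)$ extra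 space; - some algorithm computes short products in size $n$ with at most $\lambda_s\mathsf M(n)$ operations in $\mathbb K$ and at most $c_s n+O(1)$ extra space. Put $c=\max(c_m+3,\,c_s+2)$. Then there is an algorithm that, for every $n\ge 1$, given the first $n$ coefficients of power series $F,G\in\mathbb K[[X]]$ such that the constant coefficient of $G$ is invertible, where the registers of the dividend $F$ (but not those of $G$) may be overwritten, computes $F/G \bmod X^n$ with at most $$\left(\lambda_m\left(\frac{c+1}{2}+\frac1c\right)+\lambda_s\left(1+\frac1c\right)\right)\mathsf M(n)+O(n)$$ operations in $\mathbb K$ and with $O(1)$ extra space. -/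

import Mathlib

/-! ### Polynomial products -/

/-- The short product `F G mod X ^ n`. -/
noncomputable def shortProduct {K : Type*} [CommRing K] (n : ℕ) (F G : Polynomial K) :
    Polynomial K :=
  (F * G) %ₘ (Polynomial.X ^ n)

/-- The middle product `(F G div X ^ (n - 1)) mod X ^ m` of a polynomial `F` of size `m + n - 1`
and a polynomial `G` of size `n`. -/
noncomputable def middleProduct {K : Type*} [CommRing K] (m n : ℕ) (F G : Polynomial K) :
    Polynomial K :=
  ((F * G) /ₘ (Polynomial.X ^ (n - 1))) %ₘ (Polynomial.X ^ m)

/-! ### The machine: an algebraic random access machine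

The memory is a sequence of registers. A register contains either an element of the coefficient
ring `K` or a pointer, i.e. a natural number. Besides the memory there is a fixed finite set `V`
of index registers, which contain pointers. The time is the number of arithmetic operations in `K`;
the control flow and the addresses depend on the pointers only, and handling pointers and moving
data is not an operation in `K`. -/

/-- The contents of a register. -/
inductive Cell (K : Type*)
  | elem (x : K)
  | ptr (i : ℕ)

/-- Index expressions, for addresses and for loop control. `size` is the size parameter of the
problem instance; subtraction is truncated and division is Euclidean. -/
inductive IdxExpr (V : Type)
  | size
  | const (k : ℕ)
  | reg (v : V)
  | add (e₁ e₂ : IdxExpr V)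
  | sub (e₁ e₂ : IdxExpr V)
  | mul (e₁ e₂ : IdxExpr V)
  | div (e₁ e₂ : IdxExpr V)

/-- The value of an index expression, for size parameter `n` and index registers `r`. -/
def IdxExpr.eval {V : Type} (n : ℕ) (r : V → ℕ) : IdxExpr V → ℕ
  | .size => n
  | .const k => k
  | .reg v => r v
  | .add e₁ e₂ => e₁.eval n r + e₂.eval n r
  | .sub e₁ e₂ => e₁.eval n r - e₂.eval n r
  | .mul e₁ e₂ => e₁.eval n r * e₂.eval n r
  | .div e₁ e₂ => e₁.eval n r / e₂.eval n r

/-- The arithmetic operations in `K`. -/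
inductive ArithOp
  | add
  | sub
  | mul
  | div

/-- `op.Result x y z`: the operation `op`, applied to `x` and `y`, is defined and has result `z`.
Division is defined for invertible divisors only. -/
def ArithOp.Result {K : Type*} [CommRing K] (op : ArithOp) (x y z : K) : Prop :=
  match op with
  | .add => z = x + y
  | .sub => z = x - y
  | .mul => z = x * y
  | .div => IsUnit y ∧ z * y = x

/-- Programs. The arguments `d`, `a`, `b` are addresses of memory registers. -/
inductive Prog (K : Type*) (V : Type)
  | skip
  | seq (p q : Prog K V)
  /-- if `e ≠ 0` then `p` else `q` -/
  | ite (e : IdxExpr V) (p q : Prog K V)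
  /-- while `e ≠ 0` do `p` -/
  | loop (e : IdxExpr V) (p : Prog K V)
  /-- index register `v` := the value of `e` -/
  | setIdx (v : V) (e : IdxExpr V)
  /-- index register `v` := the pointer in register `a` -/
  | loadIdx (v : V) (a : IdxExpr V)
  /-- register `d` := the value of `e`, as a pointer -/
  | storeIdx (d e : IdxExpr V)
  /-- register `d` := contents of register `a` -/
  | move (d a : IdxExpr V)
  /-- register `d` := the constant `k` -/
  | const (d : IdxExpr V) (k : K)
  /-- register `d` := `op` applied to the elements in the registers `a` and `b` -/
  | arith (op : ArithOp) (d a b : IdxExpr V)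

/-- The data of the machine that stay fixed during a run: the size parameter, the number `ro` of
read-only registers (at the addresses below `ro`), the total number `total` of registers (the
registers at the addresses from `ro` to `total - 1` can be read and written), and the largest number
`bound` that is allowed as a pointer. -/
structure Machine where
  size : ℕ
  ro : ℕ
  total : ℕ
  bound : ℕ

/-- The contents of the index registers and of the memory registers. -/
structure MState (K : Type*) (V : Type) where
  idx : V → ℕ
  mem : ℕ → Cell K

/-- The value of an index expression in a state. -/
def MState.val {K : Type*} {V : Type} (s : MState K V) (m : Machine) (e : IdxExpr V) : ℕ :=
  e.eval m.size s.idx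

/-- The state after writing `i` to the index register `v`. -/
def MState.setIdx {K : Type*} {V : Type} [DecidableEq V] (s : MState K V) (v : V) (i : ℕ) :
    MState K V :=
  ⟨Function.update s.idx v i, s.mem⟩

/-- The state after writing `x` to the register at address `a`. -/
def MState.write {K : Type*} {V : Type} (s : MState K V) (a : ℕ) (x : Cell K) : MState K V :=
  ⟨s.idx, Function.update s.mem a x⟩

/-- The address `a` can be read. -/
def Machine.Readable (m : Machine) (a : ℕ) : Prop := a < m.total

/-- The address `a` can be written. -/
def Machine.Writable (m : Machine) (a : ℕ) : Prop := m.ro ≤ a ∧ a < m.total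

/-- `Exec m p s t s'`: started in the state `s`, the program `p` terminates without an illegal
access, an undefined operation or a pointer above the bound, in the state `s'` and after exactly
`t` arithmetic operations in `K`. -/
inductive Exec {K : Type*} [CommRing K] {V : Type} [DecidableEq V] (m : Machine) :
    Prog K V → MState K V → ℕ → MState K V → Prop
  | skip (s) : Exec m .skip s 0 s
  | seq {p q s₁ s₂ s₃ t₁ t₂} (hp : Exec m p s₁ t₁ s₂) (hq : Exec m q s₂ t₂ s₃) :
      Exec m (.seq p q) s₁ (t₁ + t₂) s₃
  | ite_pos {e p q s t s'} (he : s.val m e ≠ 0) (hp : Exec m p s t s') :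
      Exec m (.ite e p q) s t s'
  | ite_neg {e p q s t s'} (he : s.val m e = 0) (hq : Exec m q s t s') :
      Exec m (.ite e p q) s t s'
  | loop_done {e p s} (he : s.val m e = 0) : Exec m (.loop e p) s 0 s
  | loop_step {e p s₁ s₂ s₃ t₁ t₂} (he : s₁.val m e ≠ 0) (hp : Exec m p s₁ t₁ s₂)
      (hl : Exec m (.loop e p) s₂ t₂ s₃) : Exec m (.loop e p) s₁ (t₁ + t₂) s₃
  | setIdx {v e s} (hb : s.val m e ≤ m.bound) :
      Exec m (.setIdx v e) s 0 (s.setIdx v (s.val m e))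
  | loadIdx {v a s i} (ha : m.Readable (s.val m a)) (hi : s.mem (s.val m a) = .ptr i)
      (hb : i ≤ m.bound) : Exec m (.loadIdx v a) s 0 (s.setIdx v i)
  | storeIdx {d e s} (hd : m.Writable (s.val m d)) (hb : s.val m e ≤ m.bound) :
      Exec m (.storeIdx d e) s 0 (s.write (s.val m d) (.ptr (s.val m e)))
  | move {d a s} (hd : m.Writable (s.val m d)) (ha : m.Readable (s.val m a)) :
      Exec m (.move d a) s 0 (s.write (s.val m d) (s.mem (s.val m a)))
  | const {d k s} (hd : m.Writable (s.val m d)) :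
      Exec m (.const d k) s 0 (s.write (s.val m d) (.elem k))
  | arith {op d a b s x y z} (hd : m.Writable (s.val m d))
      (ha : m.Readable (s.val m a)) (hx : s.mem (s.val m a) = .elem x)
      (hb : m.Readable (s.val m b)) (hy : s.mem (s.val m b) = .elem y)
      (hz : op.Result x y z) :
      Exec m (.arith op d a b) s 1 (s.write (s.val m d) (.elem z))

/-! ### Algorithms, their time and their extra space -/

/-- An algorithm: one program for all sizes, with `numIdx` index registers. In size `n` it has
`work n` work registers besides the input and output registers, and its pointers are at most
`ptrFactor * (n + 1)`. -/
structure Algorithm (K : Type*) where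
  numIdx : ℕ
  prog : Prog K (Fin numIdx)
  work : ℕ → ℕ
  ptrFactor : ℕ

/-- The number of registers in size `n`, not counting those for the input and the output. -/
def Algorithm.extraSpace {K : Type*} (A : Algorithm K) (n : ℕ) : ℕ := A.numIdx + A.work n

/-- `A.Run n ro rw s t s'`: in size `n`, with `ro` read-only registers, followed by `rw`
preallocated registers that can be read and written, followed by the work registers, the algorithm
`A` leads from the state `s` to the state `s'` with `t` operations in `K`. -/
def Algorithm.Run {K : Type*} [CommRing K] (A : Algorithm K) (n ro rw : ℕ)
    (s : MState K (Fin A.numIdx)) (t : ℕ) (s' : MState K (Fin A.numIdx)) : Prop :=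
  Exec ⟨n, ro, ro + rw + A.work n, A.ptrFactor * (n + 1)⟩ A.prog s t s'

/-- The `len` registers from address `a` on contain `c 0, …, c (len - 1)`. -/
def MState.Holds {K : Type*} {V : Type} (s : MState K V) (a len : ℕ) (c : ℕ → K) : Prop :=
  ∀ i < len, s.mem (a + i) = .elem (c i)

/-- `A` computes middle products in size `(2 n - 1, n)` with at most `T n` operations in `K`.
Registers: `F` (size `2 n - 1`) and `G` (size `n`), both read-only; the output (size `n`). All
other registers have arbitrary initial contents. -/
def ComputesMiddleProduct {K : Type*} [CommRing K] (A : Algorithm K) (T : ℕ → ℝ) : Prop :=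
  ∀ n : ℕ, 1 ≤ n → ∀ F G : Polynomial K,
    F.degree < ((2 * n - 1 : ℕ) : WithBot ℕ) → G.degree < (n : WithBot ℕ) →
    ∀ s : MState K (Fin A.numIdx),
      s.Holds 0 (2 * n - 1) F.coeff → s.Holds (2 * n - 1) n G.coeff →
      ∃ (t : ℕ) (s' : MState K (Fin A.numIdx)),
        A.Run n (3 * n - 1) n s t s' ∧ (t : ℝ) ≤ T n ∧
        s'.Holds (3 * n - 1) n (middleProduct n n F G).coeff

/-- `A` computes short products in size `n` with at most `T n` operations in `K`.
Registers: `F` and `G` (size `n` each), both read-only; the output (size `n`). All other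
registers have arbitrary initial contents. -/
def ComputesShortProduct {K : Type*} [CommRing K] (A : Algorithm K) (T : ℕ → ℝ) : Prop :=
  ∀ n : ℕ, 1 ≤ n → ∀ F G : Polynomial K,
    F.degree < (n : WithBot ℕ) → G.degree < (n : WithBot ℕ) →
    ∀ s : MState K (Fin A.numIdx),
      s.Holds 0 n F.coeff → s.Holds n n G.coeff →
      ∃ (t : ℕ) (s' : MState K (Fin A.numIdx)),
        A.Run n (2 * n) n s t s' ∧ (t : ℝ) ≤ T n ∧
        s'.Holds (2 * n) n (shortProduct n F G).coeff

/-- `A` computes quotients `F / G` of power series at precision `n`, where `G` has an invertible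
constant coefficient, with at most `T n` operations in `K`, and may overwrite the dividend `F`.
Registers: the coefficients of `G` (read-only), the coefficients of `F` (can be read and written),
and the output; `n` registers each. All other registers have arbitrary initial contents. -/
def ComputesErasingDivision {K : Type*} [CommRing K] (A : Algorithm K) (T : ℕ → ℝ) : Prop :=
  ∀ n : ℕ, 1 ≤ n → ∀ F G : PowerSeries K, IsUnit (PowerSeries.constantCoeff G) →
    ∀ s : MState K (Fin A.numIdx),
      s.Holds 0 n (fun i => PowerSeries.coeff i G) →
      s.Holds n n (fun i => PowerSeries.coeff i F) →
      ∃ (t : ℕ) (s' : MState K (Fin A.numIdx)),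
        A.Run n n (2 * n) s t s' ∧ (t : ℝ) ≤ T n ∧
        s'.Holds (2 * n) n (fun i => PowerSeries.coeff i (F * Ring.inverse G))

/-! ### Total correctness with a bound on the time -/

/-! Write q = f / g and let v = 1 / g. Once the first m coefficients of q are known, the remainder f
- (q mod X^m) g equals X^m times (tail of q) · g, so multiplying its next k coefficients by v mod
X^k gives the next k coefficients of q (`IsQuot.sum_remainder_mul`). The quotient is computed in
this way in B blocks of size k, B being a constant slightly above c. Block i takes i middle
products, one for each earlier block of q (`runs_updateBlock`), and one short product with v
(`runs_scaleBlock`). The series v is itself the quotient of 1 by g, so Newton iteration consists of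
the same two steps, with doubling sizes whose sum is at most k.

Time. Superlinearity gives M(h) ≤ (M(n)/n) h for h ≤ n, so up to O(n) the cost is (M(n)/n) k (λ_m (1
+ B(B-1)/2) + λ_s (1 + B)). With Bk ≤ (1+ε)n, ck ≤ n and B - 1 ≤ c this is at most the claimed
bound: the summand λ_m/2 hidden in λ_m (c+1)/2 absorbs the error due to ε (`block_time_le`).

Space. The quotient overwrites the dividend, and the output registers are the work memory until a
final copy. They hold the zero padding up to Bk coefficients, then v mod X^k, then the output and
the work space of the current product. Since B > c strictly, Bk + ck stays below 2n by a positive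
fraction of n, which leaves room for the additive constants of the two given algorithms
(`block_space_le`). Only a zero register, a temporary register and a fixed number of index registers
are extra.

Block size. Newton iteration has to end exactly at k, so k = a · 2^j with a bounded. Choosing a of
order A makes the rounding error Bk - n at most n/A (`runs_chooseSizes`). Sizes below a constant N
use classical division.

The given algorithms are run inside this memory by translating their addresses (`Exec.translate`,
`runs_call`), which does not change the number of operations. -/

/-- Started in `s`, the program `p` terminates after at most `T` operations in `K`, in a state
that satisfies `Q`. -/
def Runs {K : Type*} [CommRing K] {V : Type} [DecidableEq V] (m : Machine) (p : Prog K V)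
    (s : MState K V) (T : ℝ) (Q : MState K V → Prop) : Prop :=
  ∃ t s', Exec m p s t s' ∧ (t : ℝ) ≤ T ∧ Q s'

namespace Runs

variable {K : Type*} [CommRing K] {V : Type} [DecidableEq V] {m : Machine} {p q : Prog K V}
  {s : MState K V} {T T₁ T₂ : ℝ} {Q R : MState K V → Prop}

theorem mono (h : Runs m p s T₁ Q) (hT : T₁ ≤ T₂) (hQ : ∀ s', Q s' → R s') : Runs m p s T₂ R := by
  obtain ⟨t, s', he, ht, hq⟩ := h
  exact ⟨t, s', he, ht.trans hT, hQ _ hq⟩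

theorem seq (hp : Runs m p s T₁ R) (hq : ∀ s', R s' → Runs m q s' T₂ Q) :
    Runs m (.seq p q) s (T₁ + T₂) Q := by
  obtain ⟨t, s', he, ht, hr⟩ := hp
  obtain ⟨t', s'', he', ht', hr'⟩ := hq s' hr
  exact ⟨t + t', s'', .seq he he', by push_cast; linarith, hr'⟩

theorem seq' (hp : Runs m p s T₁ R) (hq : ∀ s', R s' → Runs m q s' T₂ Q) (hT : T₁ + T₂ ≤ T) :
    Runs m (.seq p q) s T Q :=
  (hp.seq hq).mono hT fun _ h => h

theorem ite {e : IdxExpr V} (hp : s.val m e ≠ 0 → Runs m p s T Q)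
    (hq : s.val m e = 0 → Runs m q s T Q) : Runs m (.ite e p q) s T Q := by
  by_cases h : s.val m e = 0
  · obtain ⟨t, s', he, ht⟩ := hq h
    exact ⟨t, s', .ite_neg h he, ht⟩
  · obtain ⟨t, s', he, ht⟩ := hp h
    exact ⟨t, s', .ite_pos h he, ht⟩

theorem setIdx {v : V} {e : IdxExpr V} (hb : s.val m e ≤ m.bound)
    (hQ : Q (s.setIdx v (s.val m e))) : Runs m (.setIdx v e) s 0 Q :=
  ⟨0, _, .setIdx hb, by simp, hQ⟩

theorem move {d a : IdxExpr V} (hd : m.Writable (s.val m d)) (ha : m.Readable (s.val m a))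
    (hQ : Q (s.write (s.val m d) (s.mem (s.val m a)))) : Runs m (.move d a) s 0 Q :=
  ⟨0, _, .move hd ha, by simp, hQ⟩

theorem const {d : IdxExpr V} {k : K} (hd : m.Writable (s.val m d))
    (hQ : Q (s.write (s.val m d) (.elem k))) : Runs m (.const d k) s 0 Q :=
  ⟨0, _, .const hd, by simp, hQ⟩

theorem arith {op : ArithOp} {d a b : IdxExpr V} {x y : K} (z : K) (hd : m.Writable (s.val m d))
    (ha : m.Readable (s.val m a)) (hx : s.mem (s.val m a) = .elem x)
    (hb : m.Readable (s.val m b)) (hy : s.mem (s.val m b) = .elem y) (hz : op.Result x y z)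
    (hQ : Q (s.write (s.val m d) (.elem z))) : Runs m (.arith op d a b) s 1 Q :=
  ⟨1, _, .arith hd ha hx hb hy hz, by simp, hQ⟩

/-- Induction on the number `r` of iterations still to come, with the starting index `i` left free.
-/
theorem loop_aux {e : IdxExpr V} (I : ℕ → MState K V → Prop) (len : ℕ) (T : ℕ → ℝ)
    (hstep : ∀ i < len, ∀ st, I i st → st.val m e ≠ 0 ∧ Runs m p st (T i) (I (i + 1)))
    (hend : ∀ st, I len st → st.val m e = 0) (r : ℕ) :
    ∀ i st, i + r = len → I i st →
      Runs m (.loop e p) st (∑ j ∈ Finset.range r, T (i + j)) (I len) := by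
  induction r with
  | zero =>
    rintro i st rfl h
    exact ⟨0, st, .loop_done (hend _ h), by simp, h⟩
  | succ r ih =>
    intro i st hi h
    obtain ⟨hne, t, st', he, ht, h'⟩ := hstep i (by omega) st h
    obtain ⟨t', st'', he', ht', h''⟩ := ih (i + 1) st' (by omega) h'
    refine ⟨t + t', st'', .loop_step hne he he', ?_, h''⟩
    rw [Finset.sum_range_succ']
    have : ∀ j, i + 1 + j = i + (j + 1) := fun j => by ring
    simp only [this] at ht'
    push_cast
    simp only [add_zero]
    linarith

theorem loop {e : IdxExpr V} (I : ℕ → MState K V → Prop) (len : ℕ) (T : ℕ → ℝ)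
    (hstep : ∀ i < len, ∀ st, I i st → st.val m e ≠ 0 ∧ Runs m p st (T i) (I (i + 1)))
    (hend : ∀ st, I len st → st.val m e = 0) (h0 : I 0 s) :
    Runs m (.loop e p) s (∑ j ∈ Finset.range len, T j) (I len) := by
  simpa using loop_aux I len T hstep hend len 0 s (by simp) h0

end Runs

/-! ### Simulation of a program with translated addresses -/

/-- Substitution of index registers and of the size parameter. -/
def IdxExpr.subst {V V' : Type} (ι : V → V') : IdxExpr V → IdxExpr V' → IdxExpr V'
  | .size, sz => sz
  | .const k, _ => .const k
  | .reg v, _ => .reg (ι v)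
  | .add e f, sz => .add (e.subst ι sz) (f.subst ι sz)
  | .sub e f, sz => .sub (e.subst ι sz) (f.subst ι sz)
  | .mul e f, sz => .mul (e.subst ι sz) (f.subst ι sz)
  | .div e f, sz => .div (e.subst ι sz) (f.subst ι sz)

theorem IdxExpr.eval_subst {V V' : Type} (ι : V → V') (sz : IdxExpr V') (n : ℕ) (r : V' → ℕ)
    (e : IdxExpr V) : (e.subst ι sz).eval n r = e.eval (sz.eval n r) (r ∘ ι) := by
  induction e <;> simp_all [IdxExpr.subst, IdxExpr.eval]

/-- The program with renamed index registers, size parameter `sz`, and addresses translated by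
`adr`. -/
def Prog.translate {K : Type*} {V V' : Type} (ι : V → V') (sz : IdxExpr V')
    (adr : IdxExpr V' → IdxExpr V') : Prog K V → Prog K V'
  | .skip => .skip
  | .seq p q => .seq (p.translate ι sz adr) (q.translate ι sz adr)
  | .ite e p q => .ite (e.subst ι sz) (p.translate ι sz adr) (q.translate ι sz adr)
  | .loop e p => .loop (e.subst ι sz) (p.translate ι sz adr)
  | .setIdx v e => .setIdx (ι v) (e.subst ι sz)
  | .loadIdx v a => .loadIdx (ι v) (adr (a.subst ι sz))
  | .storeIdx d e => .storeIdx (adr (d.subst ι sz)) (e.subst ι sz)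
  | .move d a => .move (adr (d.subst ι sz)) (adr (a.subst ι sz))
  | .const d k => .const (adr (d.subst ι sz)) k
  | .arith op d a b => .arith op (adr (d.subst ι sz)) (adr (a.subst ι sz)) (adr (b.subst ι sz))

/-- The state `s'` represents the state `s` via `ι` and `φ`, and agrees with `s₀` elsewhere. -/
structure Simulates {K : Type*} {V V' : Type} (m : Machine) (ι : V → V') (φ : ℕ → ℕ)
    (s₀ : MState K V') (s : MState K V) (s' : MState K V') : Prop where
  idx : ∀ v, s'.idx (ι v) = s.idx v
  idx_frame : ∀ v', v' ∉ Set.range ι → s'.idx v' = s₀.idx v'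
  mem : ∀ a < m.total, s'.mem (φ a) = s.mem a
  mem_frame : ∀ b, (∀ a, m.Writable a → φ a ≠ b) → s'.mem b = s₀.mem b

section Simulation

variable {K : Type*} {V V' : Type} {m m' : Machine} {ι : V → V'} {φ : ℕ → ℕ} {s₀ s' : MState K V'} {s : MState K V}

theorem Simulates.setIdx [DecidableEq V] [DecidableEq V'] (h : Simulates m ι φ s₀ s s') (hι : ι.Injective) (v : V) (i : ℕ) :
    Simulates m ι φ s₀ (s.setIdx v i) (s'.setIdx (ι v) i) where
  idx w := by
    by_cases hw : w = v
    · subst hw; simp [MState.setIdx]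
    · simp [MState.setIdx, Function.update_of_ne hw, Function.update_of_ne (hι.ne hw), h.idx]
  idx_frame w hw := by
    have : w ≠ ι v := fun e => hw ⟨v, e.symm⟩
    simp [MState.setIdx, Function.update_of_ne this, h.idx_frame w hw]
  mem := h.mem
  mem_frame := h.mem_frame

/-- The map φ may identify addresses that are only read. It is enough that no other address shares
the image of a writable one, so a write is seen at a single simulated address. -/
theorem Simulates.write (h : Simulates m ι φ s₀ s s')
    (hinj : ∀ a b, m.Writable a → b < m.total → φ a = φ b → a = b) {d : ℕ} (hd : m.Writable d)
    (x : Cell K) : Simulates m ι φ s₀ (s.write d x) (s'.write (φ d) x) where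
  idx := h.idx
  idx_frame := h.idx_frame
  mem a ha := by
    by_cases hw : a = d
    · subst hw; simp [MState.write]
    · have : φ a ≠ φ d := fun e => hw (hinj d a hd ha e.symm).symm
      simp [MState.write, Function.update_of_ne hw, Function.update_of_ne this, h.mem a ha]
  mem_frame b hb := by
    simp [MState.write, Function.update_of_ne (hb d hd).symm, h.mem_frame b hb]

variable [CommRing K] [DecidableEq V] [DecidableEq V']

/-- A run changes only the caller's index registers in the range of ι. Hence `sz` and `adr` need to
have the right values only when all other index registers are as at the start of the call. The
operation count `t` is preserved exactly. -/
theorem Exec.translate {sz : IdxExpr V'} {adr : IdxExpr V' → IdxExpr V'}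
    (hι : ι.Injective) (hbound : m.bound ≤ m'.bound)
    (hinj : ∀ a b, m.Writable a → b < m.total → φ a = φ b → a = b)
    (hr : ∀ a, m.Readable a → m'.Readable (φ a)) (hw : ∀ a, m.Writable a → m'.Writable (φ a))
    (hsz : ∀ r : V' → ℕ, (∀ v, v ∉ Set.range ι → r v = s₀.idx v) → sz.eval m'.size r = m.size)
    (hadr : ∀ r : V' → ℕ, (∀ v, v ∉ Set.range ι → r v = s₀.idx v) → ∀ e,
      (adr e).eval m'.size r = φ (e.eval m'.size r))
    {p : Prog K V} {t : ℕ} {s₁ : MState K V} (he : Exec m p s t s₁) :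
    ∀ s', Simulates m ι φ s₀ s s' →
      ∃ s₁', Exec m' (p.translate ι sz adr) s' t s₁' ∧ Simulates m ι φ s₀ s₁ s₁' := by
  have hval : ∀ (s : MState K V) (s' : MState K V'), Simulates m ι φ s₀ s s' → ∀ e,
      s'.val m' (e.subst ι sz) = s.val m e := by
    intro s s' h e
    have : s'.idx ∘ ι = s.idx := funext h.idx
    simp [MState.val, IdxExpr.eval_subst, hsz _ h.idx_frame, this]
  have haval : ∀ (s : MState K V) (s' : MState K V'), Simulates m ι φ s₀ s s' → ∀ e,
      s'.val m' (adr (e.subst ι sz)) = φ (s.val m e) := by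
    intro s s' h e
    rw [MState.val, hadr _ h.idx_frame]
    exact congrArg φ (hval s s' h e)
  induction he with
  | skip s => exact fun s' h => ⟨s', .skip _, h⟩
  | seq _ _ ihp ihq =>
    intro s' h
    obtain ⟨s₁', he₁, h₁⟩ := ihp s' h
    obtain ⟨s₂', he₂, h₂⟩ := ihq s₁' h₁
    exact ⟨s₂', .seq he₁ he₂, h₂⟩
  | ite_pos hc _ ih =>
    intro s' h
    obtain ⟨s₁', he₁, h₁⟩ := ih s' h
    exact ⟨s₁', .ite_pos (by rwa [hval _ _ h]) he₁, h₁⟩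
  | ite_neg hc _ ih =>
    intro s' h
    obtain ⟨s₁', he₁, h₁⟩ := ih s' h
    exact ⟨s₁', .ite_neg (by rwa [hval _ _ h]) he₁, h₁⟩
  | loop_done hc => exact fun s' h => ⟨s', .loop_done (by rwa [hval _ _ h]), h⟩
  | loop_step hc _ _ ihp ihl =>
    intro s' h
    obtain ⟨s₁', he₁, h₁⟩ := ihp s' h
    obtain ⟨s₂', he₂, h₂⟩ := ihl s₁' h₁
    exact ⟨s₂', .loop_step (by rwa [hval _ _ h]) he₁ he₂, h₂⟩
  | @setIdx v e s hb =>
    intro s' h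
    have hv := hval _ _ h e
    exact ⟨_, .setIdx (by rw [hv]; exact hb.trans hbound), by rw [hv]; exact h.setIdx hι _ _⟩
  | @loadIdx v a s i ha hi hb =>
    intro s' h
    have hv := haval _ _ h a
    exact ⟨_, .loadIdx (by rw [hv]; exact hr _ ha) (by rw [hv, h.mem _ ha, hi])
      (hb.trans hbound), h.setIdx hι _ _⟩
  | @storeIdx d e s hd hb =>
    intro s' h
    have hv := hval _ _ h e
    have hv' := haval _ _ h d
    exact ⟨_, .storeIdx (by rw [hv']; exact hw _ hd) (by rw [hv]; exact hb.trans hbound),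
      by rw [hv, hv']; exact h.write hinj hd _⟩
  | @move d a s hd ha =>
    intro s' h
    have hv := haval _ _ h a
    have hv' := haval _ _ h d
    exact ⟨_, .move (by rw [hv']; exact hw _ hd) (by rw [hv]; exact hr _ ha),
      by rw [hv, hv', h.mem _ ha]; exact h.write hinj hd _⟩
  | @const d k s hd =>
    intro s' h
    have hv' := haval _ _ h d
    exact ⟨_, .const (by rw [hv']; exact hw _ hd), by rw [hv']; exact h.write hinj hd _⟩
  | @arith op d a b s x y z hd ha hx hb hy hz =>
    intro s' h
    have hv := haval _ _ h a
    have hvb := haval _ _ h b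
    have hv' := haval _ _ h d
    exact ⟨_, .arith (by rw [hv']; exact hw _ hd) (by rw [hv]; exact hr _ ha)
      (by rw [hv, h.mem _ ha, hx]) (by rw [hvb]; exact hr _ hb) (by rw [hvb, h.mem _ hb, hy]) hz,
      by rw [hv']; exact h.write hinj hd _⟩

/-- The callee starts in the caller's state pulled back along ι and φ. Nothing has to be
initialized, because the given algorithms accept arbitrary contents of their output and work
registers. -/
theorem Runs.translate {sz : IdxExpr V'} {adr : IdxExpr V' → IdxExpr V'}
    (hι : ι.Injective) (hbound : m.bound ≤ m'.bound)
    (hinj : ∀ a b, m.Writable a → b < m.total → φ a = φ b → a = b)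
    (hr : ∀ a, m.Readable a → m'.Readable (φ a)) (hw : ∀ a, m.Writable a → m'.Writable (φ a))
    (hsz : ∀ r : V' → ℕ, (∀ v, v ∉ Set.range ι → r v = s'.idx v) → sz.eval m'.size r = m.size)
    (hadr : ∀ r : V' → ℕ, (∀ v, v ∉ Set.range ι → r v = s'.idx v) → ∀ e,
      (adr e).eval m'.size r = φ (e.eval m'.size r))
    {p : Prog K V} {T : ℝ} {Q : MState K V → Prop}
    (h : Runs m p ⟨s'.idx ∘ ι, s'.mem ∘ φ⟩ T Q) :
    Runs m' (p.translate ι sz adr) s' T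
      (fun s₁' => ∃ s₁, Q s₁ ∧ Simulates m ι φ s' s₁ s₁') := by
  obtain ⟨t, s₁, he, ht, hQ⟩ := h
  obtain ⟨s₁', he', h'⟩ := he.translate hι hbound hinj hr hw hsz hadr s'
    ⟨fun _ => rfl, fun _ _ => rfl, fun _ _ => rfl, fun _ _ => rfl⟩
  exact ⟨t, s₁', he', ht, s₁, hQ, h'⟩

end Simulation

/-! ### Coefficients of products and quotients -/

section Coefficients

variable {K : Type*} [CommRing K]

theorem Polynomial.coeff_modByMonic_X_pow (p : Polynomial K) {n i : ℕ} (hi : i < n) :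
    (p %ₘ (Polynomial.X ^ n)).coeff i = p.coeff i := by
  conv_rhs => rw [← Polynomial.modByMonic_add_div p (Polynomial.X ^ n)]
  rw [Polynomial.coeff_add, Polynomial.coeff_X_pow_mul', if_neg (by omega), add_zero]

theorem Polynomial.coeff_divByMonic_X_pow (p : Polynomial K) (n i : ℕ) :
    (p /ₘ (Polynomial.X ^ n)).coeff i = p.coeff (i + n) := by
  nontriviality K
  conv_rhs => rw [← Polynomial.modByMonic_add_div p (Polynomial.X ^ n)]
  rw [Polynomial.coeff_add, Polynomial.coeff_X_pow_mul, right_eq_add]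
  refine Polynomial.coeff_eq_zero_of_degree_lt ?_
  refine (Polynomial.degree_modByMonic_lt p (Polynomial.monic_X_pow n)).trans_le ?_
  rw [Polynomial.degree_X_pow]
  exact_mod_cast Nat.le_add_left n i

/-- The polynomial of size `n` with coefficients `w 0, …, w (n - 1)`. -/
noncomputable def polyOfFun (n : ℕ) (w : ℕ → K) : Polynomial K :=
  ∑ i ∈ Finset.range n, Polynomial.monomial i (w i)

theorem coeff_polyOfFun (n : ℕ) (w : ℕ → K) (i : ℕ) :
    (polyOfFun n w).coeff i = if i < n then w i else 0 := by
  simp [polyOfFun, Polynomial.coeff_monomial]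

theorem degree_polyOfFun_lt (n : ℕ) (w : ℕ → K) : (polyOfFun n w).degree < (n : WithBot ℕ) := by
  rw [Polynomial.degree_lt_iff_coeff_zero]
  intro i hi
  rw [coeff_polyOfFun, if_neg (by omega)]

/-- The indices h - 1 + i - t lie in [0, 2h - 2], so the truncation of `w` to size 2h - 1 loses
nothing: each coefficient is a full sum of `h` terms. -/
theorem coeff_middleProduct {h i : ℕ} (hi : i < h) (w v : ℕ → K) :
    (middleProduct h h (polyOfFun (2 * h - 1) w) (polyOfFun h v)).coeff i =
      ∑ t ∈ Finset.range h, v t * w (h - 1 + i - t) := by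
  rw [middleProduct, Polynomial.coeff_modByMonic_X_pow _ hi, Polynomial.coeff_divByMonic_X_pow,
    mul_comm, Polynomial.coeff_mul, Finset.Nat.sum_antidiagonal_eq_sum_range_succ_mk]
  have hsub : Finset.range h ⊆ Finset.range (i + (h - 1)).succ :=
    Finset.range_subset_range.mpr (by omega)
  rw [← Finset.sum_subset hsub]
  · refine Finset.sum_congr rfl fun t ht => ?_
    rw [Finset.mem_range] at ht
    simp only [coeff_polyOfFun]
    rw [if_pos ht, if_pos (by omega), show i + (h - 1) - t = h - 1 + i - t by omega]
  · intro t _ ht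
    rw [Finset.mem_range] at ht
    simp [coeff_polyOfFun, ht]

theorem coeff_shortProduct {h i : ℕ} (hi : i < h) (w v : ℕ → K) :
    (shortProduct h (polyOfFun h w) (polyOfFun h v)).coeff i =
      ∑ t ∈ Finset.range (i + 1), w t * v (i - t) := by
  rw [shortProduct, Polynomial.coeff_modByMonic_X_pow _ hi, Polynomial.coeff_mul,
    Finset.Nat.sum_antidiagonal_eq_sum_range_succ_mk]
  refine Finset.sum_congr rfl fun t ht => ?_
  rw [Finset.mem_range] at ht
  simp only [coeff_polyOfFun]
  rw [if_pos (by omega), if_pos (by omega)]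

/-- The power series with coefficients `q` is the quotient of those with coefficients `f` and
`g`. -/
def IsQuot (f g q : ℕ → K) : Prop :=
  ∀ l, ∑ t ∈ Finset.range (l + 1), q t * g (l - t) = f l

theorem isQuot_iff (f g q : ℕ → K) :
    IsQuot f g q ↔ PowerSeries.mk q * PowerSeries.mk g = PowerSeries.mk f := by
  rw [PowerSeries.ext_iff]
  refine forall_congr' fun l => ?_
  simp [PowerSeries.coeff_mul, Finset.Nat.sum_antidiagonal_eq_sum_range_succ_mk]

theorem exists_isQuot (f : ℕ → K) {g : ℕ → K} (hg : IsUnit (g 0)) : ∃ q, IsQuot f g q := by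
  have hu : IsUnit (PowerSeries.mk g) := by
    rw [PowerSeries.isUnit_iff_constantCoeff]
    simpa [← PowerSeries.coeff_zero_eq_constantCoeff_apply] using hg
  refine ⟨fun i => PowerSeries.coeff i (PowerSeries.mk f * Ring.inverse (PowerSeries.mk g)), ?_⟩
  rw [isQuot_iff]
  have : PowerSeries.mk (fun i => PowerSeries.coeff i
      (PowerSeries.mk f * Ring.inverse (PowerSeries.mk g))) =
      PowerSeries.mk f * Ring.inverse (PowerSeries.mk g) := by ext; simp
  rw [this, mul_assoc, Ring.inverse_mul_cancel _ hu, mul_one]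

/-- Coefficient i of a quotient depends only on the coefficients up to i of dividend and divisor:
strong induction, cancelling the unit constant coefficient of G. So both series may be truncated at
n. -/
theorem IsQuot.eq_coeff {f g q : ℕ → K} (hq : IsQuot f g q) {F G : PowerSeries K}
    (hG : IsUnit (PowerSeries.constantCoeff G)) {n : ℕ}
    (hf : ∀ i < n, f i = PowerSeries.coeff i F) (hg : ∀ i < n, g i = PowerSeries.coeff i G) :
    ∀ i < n, q i = PowerSeries.coeff i (F * Ring.inverse G) := by
  have hu : IsUnit G := PowerSeries.isUnit_iff_constantCoeff.mpr hG
  set Q := F * Ring.inverse G with hQ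
  have hQG : Q * G = F := by rw [hQ, mul_assoc, Ring.inverse_mul_cancel _ hu, mul_one]
  intro i
  induction i using Nat.strong_induction_on with
  | _ i ih =>
    intro hi
    have h1 := hq i
    have h2 : ∑ t ∈ Finset.range (i + 1), PowerSeries.coeff t Q * PowerSeries.coeff (i - t) G =
        PowerSeries.coeff i F := by
      rw [← hQG, PowerSeries.coeff_mul, Finset.Nat.sum_antidiagonal_eq_sum_range_succ_mk]
    rw [hf i hi, ← h2, Finset.sum_range_succ, Finset.sum_range_succ] at h1
    have h3 : ∑ t ∈ Finset.range i, q t * g (i - t) =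
        ∑ t ∈ Finset.range i, PowerSeries.coeff t Q * PowerSeries.coeff (i - t) G := by
      refine Finset.sum_congr rfl fun t ht => ?_
      rw [Finset.mem_range] at ht
      rw [ih t ht (by omega), hg _ (by omega)]
    rw [h3, Nat.sub_self, hg 0 (by omega)] at h1
    refine hG.mul_right_cancel ?_
    simpa using add_left_cancel h1

/-- The coefficient of `X ^ l` in `f - (q mod X ^ m) g`. -/
def remainder (f g q : ℕ → K) (m l : ℕ) : K :=
  f l - ∑ t ∈ Finset.range m, q t * g (l - t)

theorem remainder_zero (f g q : ℕ → K) (l : ℕ) : remainder f g q 0 l = f l := by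
  simp [remainder]

theorem remainder_add (f g q : ℕ → K) (m h l : ℕ) : remainder f g q (m + h) l =
    remainder f g q m l - ∑ t ∈ Finset.range h, q (m + t) * g (l - (m + t)) := by
  simp [remainder, Finset.sum_range_add, sub_sub]

theorem remainder_succ (f g q : ℕ → K) (m l : ℕ) :
    remainder f g q (m + 1) l = remainder f g q m l - q m * g (l - m) := by
  simp [remainder_add]

/-- In the convolution for `f (m + l)` the first `m` terms cancel. What remains is the tail of `q`
convolved with `g`. -/
theorem IsQuot.remainder_eq {f g q : ℕ → K} (hq : IsQuot f g q) (m l : ℕ) :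
    remainder f g q m (m + l) = ∑ t ∈ Finset.range (l + 1), q (m + t) * g (l - t) := by
  rw [remainder, ← hq (m + l), add_assoc, Finset.sum_range_add, add_sub_cancel_left]
  simp [Nat.add_sub_add_left]

/-- The shifted remainder is the tail of `q` times `g`, so multiplication by 1/g recovers the tail.
The first h coefficients of the tail need only the first h coefficients of the remainder and of 1/g,
hence a short product suffices. -/
theorem IsQuot.sum_remainder_mul {f g q v : ℕ → K} (hq : IsQuot f g q)
    (hv : IsQuot (fun i => if i = 0 then 1 else 0) g v) (m l : ℕ) :
    ∑ t ∈ Finset.range (l + 1), remainder f g q m (m + t) * v (l - t) = q (m + l) := by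
  have h1 : IsQuot (fun l => remainder f g q m (m + l)) g (fun l => q (m + l)) :=
    fun l => (hq.remainder_eq m l).symm
  rw [isQuot_iff] at h1 hv
  have h2 : PowerSeries.mk (fun l => remainder f g q m (m + l)) * PowerSeries.mk v =
      PowerSeries.mk (fun l => q (m + l)) := by
    rw [← h1, mul_assoc, mul_comm (PowerSeries.mk g), hv]
    have : PowerSeries.mk (fun i => if i = 0 then (1 : K) else 0) = 1 := by
      ext i; simp [PowerSeries.coeff_one]
    rw [this, mul_one]
  have h3 := congrArg (PowerSeries.coeff l) h2
  simpa [PowerSeries.coeff_mul, Finset.Nat.sum_antidiagonal_eq_sum_range_succ_mk] using h3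

end Coefficients

/-! ### Index expressions of the calling program -/

namespace IdxExpr

variable {V : Type}

instance : Add (IdxExpr V) := ⟨.add⟩
instance : Sub (IdxExpr V) := ⟨.sub⟩
instance : Mul (IdxExpr V) := ⟨.mul⟩
instance : Div (IdxExpr V) := ⟨.div⟩
instance (k : ℕ) : OfNat (IdxExpr V) k := ⟨.const k⟩

variable (n : ℕ) (r : V → ℕ) (e f a b : IdxExpr V)

@[simp] theorem eval_size : eval n r .size = n := rfl
@[simp] theorem eval_reg (v : V) : eval n r (.reg v) = r v := rfl
@[simp] theorem eval_const (k : ℕ) : eval n r (.const k) = k := rfl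
@[simp] theorem eval_ofNat (k : ℕ) : eval n r (no_index (OfNat.ofNat k)) = k := rfl
@[simp] theorem eval_add : eval n r (e + f) = eval n r e + eval n r f := rfl
@[simp] theorem eval_sub : eval n r (e - f) = eval n r e - eval n r f := rfl
@[simp] theorem eval_mul : eval n r (e * f) = eval n r e * eval n r f := rfl
@[simp] theorem eval_div : eval n r (e / f) = eval n r e / eval n r f := rfl

/-- if `a < b` then `e` else `f` -/
def ifLt (a b e f : IdxExpr V) : IdxExpr V :=
  1 / (1 + (a + 1 - b)) * e + (1 - 1 / (1 + (a + 1 - b))) * f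

@[simp] theorem eval_ifLt : eval n r (ifLt a b e f) =
    if eval n r a < eval n r b then eval n r e else eval n r f := by
  -- Truncated subtraction makes a + 1 - b zero exactly when a < b. The quotient is then 1/1, and
  -- otherwise its denominator is at least 2.
  have h : 1 / (1 + (eval n r a + 1 - eval n r b)) =
      if eval n r a < eval n r b then 1 else 0 := by
    split_ifs with h
    · rw [Nat.sub_eq_zero_of_le h]
    · exact Nat.div_eq_of_lt (by omega)
  simp only [ifLt, eval_add, eval_mul, eval_sub, eval_div, eval_ofNat, h]
  split_ifs <;> simp

/-- An expression in the caller's registers, as an expression in all index registers. -/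
def up {X : Type} (e : IdxExpr (Fin 8)) : IdxExpr (X ⊕ Fin 8) := e.subst Sum.inr .size

end IdxExpr

/-- The contents of the caller's index registers. -/
def MState.own {K : Type*} {X : Type} (s : MState K (X ⊕ Fin 8)) (r : Fin 8) : ℕ := s.idx (.inr r)

theorem IdxExpr.eval_up {X : Type} (n : ℕ) (r : X ⊕ Fin 8 → ℕ) (e : IdxExpr (Fin 8)) :
    e.up.eval n r = e.eval n (fun i => r (.inr i)) :=
  IdxExpr.eval_subst _ _ _ _ _

@[simp] theorem MState.val_up {K : Type*} {X : Type} (s : MState K (X ⊕ Fin 8)) (m : Machine)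
    (e : IdxExpr (Fin 8)) : s.val m e.up = e.eval m.size s.own :=
  IdxExpr.eval_up _ _ _

@[simp] theorem MState.own_write {K : Type*} {X : Type} (s : MState K (X ⊕ Fin 8)) (a : ℕ)
    (x : Cell K) : (s.write a x).own = s.own := rfl

@[simp] theorem MState.own_setIdx {K : Type*} {X : Type} [DecidableEq X]
    (s : MState K (X ⊕ Fin 8)) (r : Fin 8) (i : ℕ) :
    (s.setIdx (.inr r) i).own = Function.update s.own r i := by
  funext r'
  by_cases h : r' = r <;> simp [MState.own, MState.setIdx, Function.update, h]

@[simp] theorem MState.mem_setIdx {K : Type*} {V : Type} [DecidableEq V]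
    (s : MState K V) (v : V) (i : ℕ) : (s.setIdx v i).mem = s.mem := rfl

theorem MState.mem_write {K : Type*} {V : Type} (s : MState K V) (a : ℕ) (x : Cell K) (b : ℕ) :
    (s.write a x).mem b = if b = a then x else s.mem b := by
  simp [MState.write, Function.update_apply]

/-- The machine of erasing division in size `n`: the divisor, the dividend, the output, and two
work registers. -/
def divMachine (n bound : ℕ) : Machine := ⟨n, n, n + 2 * n + 2, bound⟩

/-! ### Calls of algorithms for products -/

section Calls

variable {K : Type*} [CommRing K] {X : Type} [DecidableEq X]

/-- The address translation of a call: the addresses below `L` are read from `x₁` on, where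
addresses from `lim` on are replaced by that of the zero register, those below `ro` from `x₂` on,
and all others are mapped to the addresses from `o` on. -/
def callMap (n L ro lim x₁ x₂ o a : ℕ) : ℕ :=
  if a < L then (if x₁ + a < lim then x₁ + a else 3 * n)
  else if a < ro then x₂ + (a - L) else o + (a - ro)

/-- The address translation of a call on expressions. -/
def callAddr (L ro lim x₁ x₂ o : IdxExpr (Fin 8)) (e : IdxExpr (X ⊕ Fin 8)) :
    IdxExpr (X ⊕ Fin 8) :=
  .ifLt e L.up (.ifLt (x₁.up + e) lim.up (x₁.up + e) (3 * .size))
    (.ifLt e ro.up (x₂.up + (e - L.up)) (o.up + (e - ro.up)))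

/-- The callee's output and work registers go to the scratch area from `o` on, and its inputs stay
where they are in the caller's memory. In `hx₁` either the first input ends before the scratch area,
or it is cut off at a limit below it. -/
theorem runs_call {A : Algorithm K} {ι : Fin A.numIdx → X} (hι : ι.Injective)
    {n bound h L ro lim x₁ x₂ o tot : ℕ} {eh eL ero elim e₁ e₂ eo : IdxExpr (Fin 8)}
    {s : MState K (X ⊕ Fin 8)}
    (hh : eh.eval n s.own = h) (hL : eL.eval n s.own = L) (hro : ero.eval n s.own = ro)
    (hlim : elim.eval n s.own = lim) (h₁ : e₁.eval n s.own = x₁) (h₂ : e₂.eval n s.own = x₂)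
    (ho : eo.eval n s.own = o) (hbound : A.ptrFactor * (h + 1) ≤ bound)
    (hLro : L ≤ ro) (htot : o + tot ≤ 3 * n) (hno : n ≤ o) (hx₁ : x₁ + L ≤ o ∨ lim ≤ o) (hlim3 : lim ≤ 3 * n)
    (hx₂ : x₂ + (ro - L) ≤ o) {T : ℝ} {Q : MState K (Fin A.numIdx) → Prop}
    (hrun : Runs ⟨h, ro, ro + tot, A.ptrFactor * (h + 1)⟩ A.prog
      ⟨s.idx ∘ Sum.inl ∘ ι, s.mem ∘ callMap n L ro lim x₁ x₂ o⟩ T Q) :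
    Runs (divMachine n bound) (A.prog.translate (Sum.inl ∘ ι) eh.up (callAddr eL ero elim e₁ e₂ eo))
      s T (fun s' => s'.own = s.own ∧ (∀ b, b < o ∨ 3 * n ≤ b → s'.mem b = s.mem b) ∧
        ∃ s₁, Q s₁ ∧ ∀ a < tot, s'.mem (o + a) = s₁.mem (ro + a)) := by
  have hown : ∀ r : X ⊕ Fin 8 → ℕ, (∀ v, v ∉ Set.range (Sum.inl ∘ ι) → r v = s.idx v) →
      (fun i => r (.inr i)) = s.own := by
    intro r hr
    funext i
    exact hr _ (by simp)
  -- Every input is read from below the scratch area or from the zero register, so no write of the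
  -- callee can damage it.
  have hlt : ∀ a < ro, callMap n L ro lim x₁ x₂ o a < o ∨ callMap n L ro lim x₁ x₂ o a = 3 * n := by
    intro a ha
    unfold callMap
    split_ifs <;> omega
  have hge : ∀ a, ro ≤ a → callMap n L ro lim x₁ x₂ o a = o + (a - ro) := by
    intro a ha
    rw [callMap, if_neg (by omega), if_neg (by omega)]
  refine (Runs.translate (φ := callMap n L ro lim x₁ x₂ o) (Sum.inl_injective.comp hι) ?_ ?_ ?_ ?_
    ?_ ?_ hrun).mono le_rfl ?_
  · exact hbound
  · rintro a b ⟨ha, ha'⟩ hb h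
    simp only at ha ha' hb
    rw [hge a ha] at h
    by_cases hb' : b < ro
    · have := hlt b hb'
      omega
    · rw [hge b (by omega)] at h
      omega
  · intro a ha
    simp only [Machine.Readable, divMachine] at ha ⊢
    by_cases ha' : a < ro
    · have := hlt a ha'
      omega
    · rw [hge a (by omega)]
      omega
  · rintro a ⟨ha, ha'⟩
    simp only at ha ha'
    simp only [Machine.Writable, divMachine]
    rw [hge a ha]
    omega
  · intro r hr
    simp only [divMachine]
    rw [IdxExpr.eval_up, hown r hr, hh]
  · intro r hr e
    simp only [divMachine, callAddr, callMap, IdxExpr.eval_ifLt, IdxExpr.eval_up, hown r hr,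
      IdxExpr.eval_add, IdxExpr.eval_sub, IdxExpr.eval_mul, IdxExpr.eval_size, IdxExpr.eval_ofNat,
      hL, hro, hlim, h₁, h₂, ho]
    rfl
  · rintro s' ⟨s₁, hQ, hs⟩
    refine ⟨funext fun i => hs.idx_frame _ (by simp), fun b hb => hs.mem_frame b ?_, s₁, hQ, ?_⟩
    · rintro a ⟨ha, ha'⟩
      simp only at ha ha'
      rw [hge a ha]
      omega
    · intro a ha
      rw [← hs.mem _ (by simpa using ha), hge _ (by omega), Nat.add_sub_cancel_left]

/-- The call of a middle product in size `eh`, of `F` at `eg` (in the divisor) and `G` at `eq`, with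
output at `eo`. -/
def midCall (A : Algorithm K) (ι : Fin A.numIdx → X) (eh eg eq eo : IdxExpr (Fin 8)) :
    Prog K (X ⊕ Fin 8) :=
  A.prog.translate (Sum.inl ∘ ι) eh.up (callAddr (2 * eh - 1) (3 * eh - 1) .size eg eq eo)

/-- The first factor is a window of the divisor that may reach beyond its n registers. The missing
coefficients are all read from the zero register, so no padded copy of the read-only divisor is
needed. -/
theorem runs_midCall {A : Algorithm K} {T : ℕ → ℝ} (hA : ComputesMiddleProduct A T)
    {ι : Fin A.numIdx → X} (hι : ι.Injective)
    {n bound h x₁ x₂ o : ℕ} {eh e₁ e₂ eo : IdxExpr (Fin 8)} {s : MState K (X ⊕ Fin 8)}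
    (hh : eh.eval n s.own = h) (h₁ : e₁.eval n s.own = x₁) (h₂ : e₂.eval n s.own = x₂)
    (ho : eo.eval n s.own = o) (hbound : A.ptrFactor * (h + 1) ≤ bound) (hpos : 1 ≤ h)
    (htot : o + h + A.work h ≤ 3 * n) (hno : n ≤ o) (hx₂ : x₂ + h ≤ o)
    {g v : ℕ → K} (hg : ∀ i < n, s.mem i = .elem (g i)) (hg0 : ∀ i, n ≤ i → g i = 0)
    (hz : s.mem (3 * n) = .elem 0) (hv : s.Holds x₂ h v) :
    Runs (divMachine n bound) (midCall A ι eh e₁ e₂ eo) s (T h) (fun s' => s'.own = s.own ∧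
      (∀ b, b < o ∨ 3 * n ≤ b → s'.mem b = s.mem b) ∧
      s'.Holds o h (fun i => ∑ t ∈ Finset.range h, v t * g (x₁ + (h - 1 + i - t)))) := by
  have hL : (2 * eh - 1 : IdxExpr (Fin 8)).eval n s.own = 2 * h - 1 := by simp [hh]
  have hro : (3 * eh - 1 : IdxExpr (Fin 8)).eval n s.own = 3 * h - 1 := by simp [hh]
  obtain ⟨t, s₁, hrun, ht, hout⟩ := hA h hpos (polyOfFun (2 * h - 1) fun i => g (x₁ + i))
    (polyOfFun h v) (degree_polyOfFun_lt _ _) (degree_polyOfFun_lt _ _)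
    ⟨s.idx ∘ Sum.inl ∘ ι, s.mem ∘ callMap n (2 * h - 1) (3 * h - 1) n x₁ x₂ o⟩
    (by
      intro i hi
      rw [coeff_polyOfFun, if_pos hi]
      simp only [Function.comp, callMap, zero_add, if_pos hi]
      split_ifs with hn
      · exact hg _ hn
      · rw [hg0 _ (by omega), hz])
    (by
      intro i hi
      rw [coeff_polyOfFun, if_pos hi]
      simp only [Function.comp, callMap]
      rw [if_neg (by omega), if_pos (by omega), Nat.add_sub_cancel_left]
      exact hv i hi)
  have hrun' : Runs ⟨h, 3 * h - 1, 3 * h - 1 + (h + A.work h), A.ptrFactor * (h + 1)⟩ A.prog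
      ⟨s.idx ∘ Sum.inl ∘ ι, s.mem ∘ callMap n (2 * h - 1) (3 * h - 1) n x₁ x₂ o⟩ (T h)
      (fun s₁ => s₁.Holds (3 * h - 1) h (middleProduct h h
        (polyOfFun (2 * h - 1) fun i => g (x₁ + i)) (polyOfFun h v)).coeff) :=
    ⟨t, s₁, by simpa only [Algorithm.Run, add_assoc] using hrun, ht, hout⟩
  refine (runs_call hι hh hL hro (IdxExpr.eval_size _ _) h₁ h₂ ho hbound (by omega) (by omega) hno (Or.inr hno)
    (by omega) (by omega) hrun').mono le_rfl ?_
  rintro s' ⟨hown, hfr, s₂, hs₂, hmem⟩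
  refine ⟨hown, hfr, fun i hi => ?_⟩
  rw [hmem i (by omega), hs₂ i hi, coeff_middleProduct hi]

/-- The call of a short product in size `eh`, of `F` at `e₁` and `G` at `e₂`, with output
at `eo`. -/
def shortCall (A : Algorithm K) (ι : Fin A.numIdx → X) (eh e₁ e₂ eo : IdxExpr (Fin 8)) :
    Prog K (X ⊕ Fin 8) :=
  A.prog.translate (Sum.inl ∘ ι) eh.up (callAddr eh (2 * eh) (3 * .size) e₁ e₂ eo)

theorem runs_shortCall {A : Algorithm K} {T : ℕ → ℝ} (hA : ComputesShortProduct A T)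
    {ι : Fin A.numIdx → X} (hι : ι.Injective)
    {n bound h x₁ x₂ o : ℕ} {eh e₁ e₂ eo : IdxExpr (Fin 8)} {s : MState K (X ⊕ Fin 8)}
    (hh : eh.eval n s.own = h) (h₁ : e₁.eval n s.own = x₁) (h₂ : e₂.eval n s.own = x₂)
    (ho : eo.eval n s.own = o) (hbound : A.ptrFactor * (h + 1) ≤ bound) (hpos : 1 ≤ h)
    (htot : o + h + A.work h ≤ 3 * n) (hno : n ≤ o) (hx₁ : x₁ + h ≤ o) (hx₂ : x₂ + h ≤ o)
    {w v : ℕ → K} (hw : s.Holds x₁ h w) (hv : s.Holds x₂ h v) :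
    Runs (divMachine n bound) (shortCall A ι eh e₁ e₂ eo) s (T h) (fun s' => s'.own = s.own ∧
      (∀ b, b < o ∨ 3 * n ≤ b → s'.mem b = s.mem b) ∧
      s'.Holds o h (fun i => ∑ t ∈ Finset.range (i + 1), w t * v (i - t))) := by
  have hro : (2 * eh : IdxExpr (Fin 8)).eval n s.own = 2 * h := by simp [hh]
  have hlim : (3 * .size : IdxExpr (Fin 8)).eval n s.own = 3 * n := by simp
  obtain ⟨t, s₁, hrun, ht, hout⟩ := hA h hpos (polyOfFun h w)
    (polyOfFun h v) (degree_polyOfFun_lt _ _) (degree_polyOfFun_lt _ _)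
    ⟨s.idx ∘ Sum.inl ∘ ι, s.mem ∘ callMap n h (2 * h) (3 * n) x₁ x₂ o⟩
    (by
      intro i hi
      rw [coeff_polyOfFun, if_pos hi]
      simp only [Function.comp, callMap, zero_add, if_pos hi]
      rw [if_pos (by omega)]
      exact hw i hi)
    (by
      intro i hi
      rw [coeff_polyOfFun, if_pos hi]
      simp only [Function.comp, callMap]
      rw [if_neg (by omega), if_pos (by omega), Nat.add_sub_cancel_left]
      exact hv i hi)
  have hrun' : Runs ⟨h, 2 * h, 2 * h + (h + A.work h), A.ptrFactor * (h + 1)⟩ A.prog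
      ⟨s.idx ∘ Sum.inl ∘ ι, s.mem ∘ callMap n h (2 * h) (3 * n) x₁ x₂ o⟩ (T h)
      (fun s₁ => s₁.Holds (2 * h) h (shortProduct h (polyOfFun h w) (polyOfFun h v)).coeff) :=
    ⟨t, s₁, by simpa only [Algorithm.Run, add_assoc] using hrun, ht, hout⟩
  refine (runs_call hι hh hh hro hlim h₁ h₂ ho hbound (by omega) (by omega) hno (Or.inl (by omega))
    le_rfl (by omega) hrun').mono le_rfl ?_
  rintro s' ⟨hown, hfr, s₂, hs₂, hmem⟩
  refine ⟨hown, hfr, fun i hi => ?_⟩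
  rw [hmem i (by omega), hs₂ i hi, coeff_shortProduct hi]

end Calls

/-! ### Loops of the calling program -/

section Subroutines

variable {K : Type*} [CommRing K] {X : Type} [DecidableEq X]

/-- for `r` from `0` to `N - 1` do `body` -/
def forUp (r : Fin 8) (N : IdxExpr (Fin 8)) (body : Prog K (X ⊕ Fin 8)) : Prog K (X ⊕ Fin 8) :=
  .seq (.setIdx (.inr r) (IdxExpr.up 0))
    (.loop (N - .reg r).up (.seq body (.setIdx (.inr r) (.up (.reg r + 1)))))

theorem runs_forUp {m : Machine} {r : Fin 8} {N : IdxExpr (Fin 8)} {body : Prog K (X ⊕ Fin 8)}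
    {s : MState K (X ⊕ Fin 8)} {len : ℕ} (T : ℕ → ℝ) (I : ℕ → MState K (X ⊕ Fin 8) → Prop)
    (hlen : len ≤ m.bound) (h0 : I 0 (s.setIdx (.inr r) 0))
    (hI : ∀ i st, I i st → st.own r = i ∧ N.eval m.size st.own = len)
    (hstep : ∀ i < len, ∀ st, I i st → Runs m body st (T i)
      (fun st' => st'.own r = i ∧ I (i + 1) (st'.setIdx (.inr r) (i + 1)))) :
    Runs m (forUp r N body) s (∑ i ∈ Finset.range len, T i) (I len) := by
  refine Runs.seq' (T₁ := 0) (R := I 0) (Runs.setIdx (by simp) (by simpa using h0)) ?_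
    (zero_add _).le
  intro s' h
  refine Runs.loop I len T ?_ ?_ h
  · intro i hi st hst
    obtain ⟨h1, h2⟩ := hI i st hst
    refine ⟨by simp [h1, h2]; omega, (hstep i hi st hst).seq' (T₂ := 0) ?_ (add_zero _).le⟩
    rintro st' ⟨h3, h4⟩
    exact Runs.setIdx (by simp [h3]; omega) (by simpa [h3] using h4)
  · intro st hst
    obtain ⟨h1, h2⟩ := hI len st hst
    simp [h1, h2]

/-- A loop that writes `w 0, …, w (len - 1)` to the registers from `d` on, and may use the
register `tmp`. -/
theorem runs_pass {m : Machine} {N : IdxExpr (Fin 8)} {body : Prog K (X ⊕ Fin 8)}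
    {s : MState K (X ⊕ Fin 8)} {len d tmp : ℕ} {w : ℕ → Cell K} (τ : ℝ)
    (hlen : len ≤ m.bound) (htmp : d + len ≤ tmp)
    (hN : ∀ ρ : Fin 8 → ℕ, (∀ r ≠ 5, ρ r = s.own r) → N.eval m.size ρ = len)
    (hbody : ∀ i < len, ∀ st : MState K (X ⊕ Fin 8), (∀ r ≠ 5, st.own r = s.own r) →
      st.own 5 = i → (∀ b, b < d ∨ d + i ≤ b → b ≠ tmp → st.mem b = s.mem b) →
      Runs m body st τ (fun st' => st'.own = st.own ∧ st'.mem (d + i) = w i ∧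
        ∀ b, b ≠ d + i → b ≠ tmp → st'.mem b = st.mem b)) :
    Runs m (forUp 5 N body) s (len * τ) (fun st => (∀ r ≠ 5, st.own r = s.own r) ∧
      (∀ i < len, st.mem (d + i) = w i) ∧
      ∀ b, b < d ∨ d + len ≤ b → b ≠ tmp → st.mem b = s.mem b) := by
  have h := runs_forUp (m := m) (r := 5) (N := N) (body := body) (s := s) (fun _ => τ)
    (fun i st => i ≤ len ∧ st.own 5 = i ∧ (∀ r ≠ 5, st.own r = s.own r) ∧
      (∀ j < i, st.mem (d + j) = w j) ∧
      ∀ b, b < d ∨ d + i ≤ b → b ≠ tmp → st.mem b = s.mem b) hlen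
    (by
      refine ⟨Nat.zero_le _, by simp, fun r hr => by simp [hr], by simp, fun b _ _ => rfl⟩)
    (fun i st hst => ⟨hst.2.1, hN _ hst.2.2.1⟩)
    (by
      rintro i hi st ⟨-, h5, hown, hw, hfr⟩
      refine (hbody i hi st hown h5 hfr).mono le_rfl ?_
      rintro st' ⟨ho', hw', hfr'⟩
      refine ⟨by rw [ho', h5], hi, by simp, fun r hr => by simp [hr, ho', hown r hr], ?_, ?_⟩
      · intro j hj
        rw [MState.mem_setIdx]
        rcases Nat.lt_succ_iff_lt_or_eq.mp hj with hj | rfl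
        · rw [hfr' _ (by omega) (by omega), hw j hj]
        · exact hw'
      · intro b hb hb'
        rw [MState.mem_setIdx, hfr' b (by omega) hb', hfr b (by omega) hb'])
  refine h.mono (by simp) ?_
  rintro st ⟨-, -, h1, h2, h3⟩
  exact ⟨h1, h2, h3⟩

/-! ### Division by the classical algorithm, in place -/

/-- The address of the temporary register. -/
def tmpAddr : IdxExpr (Fin 8) := 3 * .size + 1

/-- Replaces `N` coefficients of a power series, from the address `base` on, by those of its
quotient by the divisor. -/
def naiveDiv (base N : IdxExpr (Fin 8)) : Prog K (X ⊕ Fin 8) :=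
  forUp 3 N (.seq (.arith .div (base + .reg 3).up (base + .reg 3).up (IdxExpr.up 0))
    (forUp 5 (N - (.reg 3 + 1)) (.seq
      (.arith .mul tmpAddr.up (base + .reg 3).up (.up (.reg 5 + 1)))
      (.arith .sub (base + .reg 3 + 1 + .reg 5).up (base + .reg 3 + 1 + .reg 5).up tmpAddr.up))))

/-- After `i` rounds the first `i` registers hold quotient coefficients and the others hold
coefficients of the remainder for precision `i`. A round takes one division and two operations per
later coefficient, at most 2L in all. -/
theorem runs_naiveDiv {n bound b₀ L : ℕ} {base N : IdxExpr (Fin 8)} {s : MState K (X ⊕ Fin 8)}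
    {f g q : ℕ → K} (hq : IsQuot f g q) (hu : IsUnit (g 0))
    (hbase : ∀ ρ : Fin 8 → ℕ, (∀ r, r ≠ 3 → r ≠ 5 → ρ r = s.own r) → base.eval n ρ = b₀)
    (hN : ∀ ρ : Fin 8 → ℕ, (∀ r, r ≠ 3 → r ≠ 5 → ρ r = s.own r) → N.eval n ρ = L)
    (hLn : L ≤ n) (hb₀ : n ≤ b₀) (hb : b₀ + L ≤ 3 * n + 1) (hbound : n ≤ bound)
    (hg : ∀ i < n, s.mem i = .elem (g i)) (hf : s.Holds b₀ L f) :
    Runs (divMachine n bound) (naiveDiv base N) s (2 * L ^ 2 : ℕ) (fun st =>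
      (∀ r, r ≠ 3 → r ≠ 5 → st.own r = s.own r) ∧ st.Holds b₀ L q ∧
      ∀ b, b < b₀ ∨ b₀ + L ≤ b → b ≠ 3 * n + 1 → st.mem b = s.mem b) := by
  have hlt : ∀ i < L, ∀ b, (b < b₀ + L ∧ n ≤ b) → (divMachine n bound).Writable b := by
    intro i _ b hb
    simp only [divMachine, Machine.Writable]
    omega
  have h := runs_forUp (m := divMachine n bound) (r := 3) (N := N)
    (body := .seq (.arith .div (base + .reg 3).up (base + .reg 3).up (IdxExpr.up 0))
      (forUp 5 (N - (.reg 3 + 1)) (.seq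
        (.arith .mul tmpAddr.up (base + .reg 3).up (.up (.reg 5 + 1)))
        (.arith .sub (base + .reg 3 + 1 + .reg 5).up (base + .reg 3 + 1 + .reg 5).up
          tmpAddr.up)))) (s := s) (len := L) (fun _ => 2 * L)
    (fun i st => i ≤ L ∧ st.own 3 = i ∧ (∀ r, r ≠ 3 → r ≠ 5 → st.own r = s.own r) ∧
      (∀ t < i, st.mem (b₀ + t) = .elem (q t)) ∧
      (∀ l, i ≤ l → l < L → st.mem (b₀ + l) = .elem (remainder f g q i l)) ∧
      ∀ b, b < b₀ ∨ b₀ + L ≤ b → b ≠ 3 * n + 1 → st.mem b = s.mem b)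
    (by simp only [divMachine]; omega)
    (by
      refine ⟨Nat.zero_le _, by simp, fun r hr _ => by simp [hr], by simp, fun l _ hl => ?_,
        fun b _ _ => rfl⟩
      rw [remainder_zero]
      exact hf l hl)
    (fun i st hst => ⟨hst.2.1, hN _ hst.2.2.1⟩)
    (by
      rintro i hi st ⟨-, h3, hown, hqs, hrs, hfr⟩
      have hb0 : base.eval n st.own = b₀ := hbase _ hown
      have hgs : ∀ j < n, st.mem j = .elem (g j) := fun j hj => by
        rw [hfr j (by omega) (by omega), hg j hj]
      -- The leading coefficient of the remainder is q_i g_0, so the next quotient coefficient is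
      -- obtained by dividing it by the unit g_0.
      have hdiv : remainder f g q i i = q i * g 0 := by
        have := hq.remainder_eq i 0
        simpa using this
      refine Runs.seq' (T₁ := 1) (T₂ := (L - (i + 1) : ℕ) * 2)
        (R := fun st' => st' = st.write (b₀ + i) (.elem (q i))) ?_ ?_ ?_
      · refine Runs.arith (x := remainder f g q i i) (y := g 0) (q i) ?_ ?_ ?_ ?_ ?_ ?_ ?_
        · simp only [MState.val_up, divMachine, Machine.Writable, IdxExpr.eval_add,
            IdxExpr.eval_reg, h3, hb0]
          omega
        · simp only [MState.val_up, divMachine, Machine.Readable, IdxExpr.eval_add,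
            IdxExpr.eval_reg, h3, hb0]
          omega
        · simp only [MState.val_up, divMachine, IdxExpr.eval_add, IdxExpr.eval_reg, h3, hb0]
          exact hrs i le_rfl hi
        · simp [divMachine, Machine.Readable]
        · simpa [divMachine] using hgs 0 (by omega)
        · exact ⟨hu, hdiv.symm⟩
        · simp [divMachine, h3, hb0]
      · rintro st₁ rfl
        refine (runs_pass (m := divMachine n bound) (d := b₀ + i + 1) (len := L - (i + 1))
          (tmp := 3 * n + 1) (w := fun l => .elem (remainder f g q (i + 1) (i + 1 + l))) 2
          ?_ ?_ ?_ ?_).mono le_rfl ?_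
        · simp only [divMachine]; omega
        · omega
        · intro ρ hρ
          have h3' : ρ 3 = i := by rw [hρ 3 (by decide)]; exact h3
          have : N.eval n ρ = L := hN ρ fun r hr hr' => by rw [hρ r hr']; exact hown r hr hr'
          simp [divMachine, h3', this]
        · intro l hl st₂ ho h5 hm
          have ho3 : st₂.own 3 = i := by rw [ho 3 (by decide)]; exact h3
          have hb2 : base.eval n st₂.own = b₀ :=
            hbase _ fun r hr hr' => by rw [ho r hr']; exact hown r hr hr'
          have hmi : st₂.mem (b₀ + i) = .elem (q i) := by
            rw [hm _ (by omega) (by omega), MState.mem_write, if_pos rfl]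
          have hml : st₂.mem (l + 1) = .elem (g (l + 1)) := by
            rw [hm _ (by omega) (by omega), MState.mem_write, if_neg (by omega),
              hgs _ (by omega)]
          have hmr : st₂.mem (b₀ + i + 1 + l) = .elem (remainder f g q i (i + 1 + l)) := by
            rw [hm _ (by omega) (by omega), MState.mem_write, if_neg (by omega),
              show b₀ + i + 1 + l = b₀ + (i + 1 + l) by ring, hrs _ (by omega) (by omega)]
          refine Runs.seq' (T₁ := 1) (T₂ := 1)
            (R := fun st' => st' = st₂.write (3 * n + 1) (.elem (q i * g (l + 1)))) ?_ ?_
            (by norm_num)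
          · refine Runs.arith (x := q i) (y := g (l + 1)) (q i * g (l + 1)) ?_ ?_ ?_ ?_ ?_ rfl ?_
            · simp only [MState.val_up, divMachine, Machine.Writable, tmpAddr, IdxExpr.eval_add,
                IdxExpr.eval_mul, IdxExpr.eval_size, IdxExpr.eval_ofNat]
              omega
            · simp only [MState.val_up, divMachine, Machine.Readable, IdxExpr.eval_add,
                IdxExpr.eval_reg, ho3, hb2]
              omega
            · simpa [divMachine, ho3, hb2] using hmi
            · simp only [MState.val_up, divMachine, Machine.Readable, IdxExpr.eval_add,
                IdxExpr.eval_reg, h5, IdxExpr.eval_ofNat]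
              omega
            · simpa [divMachine, h5] using hml
            · simp [divMachine, tmpAddr]
          · rintro st₃ rfl
            refine Runs.arith (x := remainder f g q i (i + 1 + l)) (y := q i * g (l + 1))
              (remainder f g q (i + 1) (i + 1 + l)) ?_ ?_ ?_ ?_ ?_ ?_ ?_
            · simp only [MState.val_up, divMachine, Machine.Writable, IdxExpr.eval_add,
                IdxExpr.eval_reg, IdxExpr.eval_ofNat, MState.own_write, ho3, hb2, h5]
              omega
            · simp only [MState.val_up, divMachine, Machine.Readable, IdxExpr.eval_add,
                IdxExpr.eval_reg, IdxExpr.eval_ofNat, MState.own_write, ho3, hb2, h5]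
              omega
            · simp only [MState.val_up, divMachine, IdxExpr.eval_add,
                IdxExpr.eval_reg, IdxExpr.eval_ofNat, MState.own_write, ho3, hb2, h5]
              rw [MState.mem_write, if_neg (by omega), hmr]
            · simp only [MState.val_up, divMachine, Machine.Readable, tmpAddr, IdxExpr.eval_add,
                IdxExpr.eval_mul, IdxExpr.eval_size, IdxExpr.eval_ofNat]
              omega
            · simp [divMachine, tmpAddr, MState.mem_write]
            · simp only [ArithOp.Result]
              rw [remainder_succ, show i + 1 + l - i = l + 1 by omega]
            · simp only [MState.val_up, divMachine, IdxExpr.eval_add,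
                IdxExpr.eval_reg, IdxExpr.eval_ofNat, MState.own_write, ho3, hb2, h5]
              refine ⟨trivial, by rw [MState.mem_write, if_pos rfl], fun b hb hb' => ?_⟩
              rw [MState.mem_write, if_neg hb, MState.mem_write, if_neg hb']
        · rintro st₂ ⟨ho, hw, hm⟩
          refine ⟨by rw [ho 3 (by decide)]; exact h3, hi, by simp, ?_, ?_, ?_, ?_⟩
          · intro r hr hr'
            simp only [MState.own_setIdx, Function.update_of_ne hr]
            rw [ho r hr']
            exact hown r hr hr'
          · intro t ht
            rw [MState.mem_setIdx, hm _ (by omega) (by omega), MState.mem_write]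
            split_ifs with h
            · rw [show t = i by omega]
            · exact hqs t (by omega)
          · intro l hl hl'
            have := hw (l - (i + 1)) (by omega)
            rw [show b₀ + i + 1 + (l - (i + 1)) = b₀ + l by omega,
              show i + 1 + (l - (i + 1)) = l by omega] at this
            exact this
          · intro b hb hb'
            rw [MState.mem_setIdx, hm b (by omega) hb', MState.mem_write, if_neg (by omega),
              hfr b hb hb']
      · have : ((L - (i + 1) : ℕ) : ℝ) = L - (i + 1) := by
          rw [Nat.cast_sub (by omega)]; push_cast; ring
        rw [this]
        have : (0 : ℝ) ≤ i := i.cast_nonneg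
        linarith)
  refine h.mono ?_ ?_
  · simp
    nlinarith
  · rintro st ⟨-, -, h1, h2, -, h4⟩
    exact ⟨h1, h2, h4⟩

end Subroutines

/-! ### Block steps -/

section Blocks

variable {K : Type*} [CommRing K] {X : Type} [DecidableEq X]

/-- Subtracts from the block of size `eh` at `ed` the middle product of the divisor, from `eg` on,
and the block at `eq`. -/
def updateBlock (A : Algorithm K) (ι : Fin A.numIdx → X) (eh eg eq ed eo : IdxExpr (Fin 8)) :
    Prog K (X ⊕ Fin 8) :=
  .seq (midCall A ι eh eg eq eo)
    (forUp 5 eh (.arith .sub (ed + .reg 5).up (ed + .reg 5).up (eo + .reg 5).up))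

/-- To remove the block of `q` at offset m from the remainder block at offset D, g is needed at D +
i - (m + t). By `hD` this is x₁ + (h - 1 + i - t), which is the index pattern of a middle product of
the window of g starting at x₁. The extra h in the time counts the subtractions. -/
theorem runs_updateBlock {A : Algorithm K} {T : ℕ → ℝ} (hA : ComputesMiddleProduct A T)
    {ι : Fin A.numIdx → X} (hι : ι.Injective)
    {n bound h x₁ b m D o : ℕ} {eh eg eq ed eo : IdxExpr (Fin 8)} {s : MState K (X ⊕ Fin 8)}
    (hh : ∀ ρ : Fin 8 → ℕ, (∀ r ≠ 5, ρ r = s.own r) → eh.eval n ρ = h)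
    (h₁ : eg.eval n s.own = x₁) (h₂ : eq.eval n s.own = b + m)
    (hd : ∀ ρ : Fin 8 → ℕ, (∀ r ≠ 5, ρ r = s.own r) → ed.eval n ρ = b + D)
    (ho : ∀ ρ : Fin 8 → ℕ, (∀ r ≠ 5, ρ r = s.own r) → eo.eval n ρ = o)
    (hbound : A.ptrFactor * (h + 1) ≤ bound) (hpos : 1 ≤ h) (hhb : h ≤ bound)
    (htot : o + h + A.work h ≤ 3 * n) (hnb : n ≤ b) (hm : b + m + h ≤ o) (hDo : b + D + h ≤ o)
    (hD : D + 1 = m + x₁ + h)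
    {f g q : ℕ → K} (hg : ∀ i < n, s.mem i = .elem (g i)) (hg0 : ∀ i, n ≤ i → g i = 0)
    (hz : s.mem (3 * n) = .elem 0) (hq : s.Holds (b + m) h (fun x => q (m + x)))
    (hf : s.Holds (b + D) h (fun x => remainder f g q m (D + x))) :
    Runs (divMachine n bound) (updateBlock A ι eh eg eq ed eo) s (T h + h) (fun s' =>
      (∀ r ≠ 5, s'.own r = s.own r) ∧
      s'.Holds (b + D) h (fun x => remainder f g q (m + h) (D + x)) ∧
      ∀ c, (c < b + D ∨ b + D + h ≤ c) → (c < o ∨ c = 3 * n) → s'.mem c = s.mem c) := by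
  refine Runs.seq (runs_midCall hA hι (hh _ fun _ _ => rfl) h₁ h₂ (ho _ fun _ _ => rfl) hbound
    hpos htot (by omega) hm hg hg0 hz hq) ?_
  rintro s₁ ⟨hown, hfr, hout⟩
  refine (runs_pass (m := divMachine n bound) (d := b + D) (len := h) (tmp := 3 * n + 1)
    (w := fun x => .elem (remainder f g q (m + h) (D + x))) 1 hhb (by omega) ?_ ?_).mono
    (by simp) ?_
  · intro ρ hρ
    exact hh ρ fun r hr => by rw [hρ r hr, hown]
  · intro i hi st hst h5 hmem
    have hd' := hd st.own fun r hr => by rw [hst r hr, hown]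
    have ho' := ho st.own fun r hr => by rw [hst r hr, hown]
    refine Runs.arith (x := remainder f g q m (D + i))
      (y := ∑ t ∈ Finset.range h, q (m + t) * g (x₁ + (h - 1 + i - t))) _ ?_ ?_ ?_ ?_ ?_ rfl ?_
    · simp only [MState.val_up, divMachine, Machine.Writable, IdxExpr.eval_add,
        IdxExpr.eval_reg, hd', h5]
      omega
    · simp only [MState.val_up, divMachine, Machine.Readable, IdxExpr.eval_add,
        IdxExpr.eval_reg, hd', h5]
      omega
    · simp only [MState.val_up, divMachine, IdxExpr.eval_add, IdxExpr.eval_reg, hd', h5]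
      rw [hmem _ (by omega) (by omega), hfr _ (by omega), hf i hi]
    · simp only [MState.val_up, divMachine, Machine.Readable, IdxExpr.eval_add,
        IdxExpr.eval_reg, ho', h5]
      omega
    · simp only [MState.val_up, divMachine, IdxExpr.eval_add, IdxExpr.eval_reg, ho', h5]
      rw [hmem _ (by omega) (by omega), hout i hi]
    · simp only [MState.val_up, divMachine, IdxExpr.eval_add, IdxExpr.eval_reg, hd', h5,
        MState.own_write]
      refine ⟨trivial, ?_, fun c hc _ => by rw [MState.mem_write, if_neg hc]⟩
      rw [MState.mem_write, if_pos rfl, remainder_add]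
      congr 2
      refine Finset.sum_congr rfl fun t ht => ?_
      rw [Finset.mem_range] at ht
      rw [show D + i - (m + t) = x₁ + (h - 1 + i - t) by omega]
  · rintro s₂ ⟨hown₂, hw, hm₂⟩
    refine ⟨fun r hr => by rw [hown₂ r hr, hown], fun i hi => hw i hi, fun c hc hc' => ?_⟩
    rw [hm₂ c hc (by omega), hfr c (by omega)]

/-- Replaces the block of size `eh` at `ed` by its short product with the block at `ev`. -/
def scaleBlock (A : Algorithm K) (ι : Fin A.numIdx → X) (eh ed ev eo : IdxExpr (Fin 8)) :
    Prog K (X ⊕ Fin 8) :=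
  .seq (shortCall A ι eh ed ev eo)
    (forUp 5 eh (.move (ed + .reg 5).up (eo + .reg 5).up))

/-- The product is formed in the scratch area and then moved onto the block, since its factors must
remain readable while it is computed. Moves cost no operation in `K`. -/
theorem runs_scaleBlock {A : Algorithm K} {T : ℕ → ℝ} (hA : ComputesShortProduct A T)
    {ι : Fin A.numIdx → X} (hι : ι.Injective)
    {n bound h b m b' o : ℕ} {eh ed ev eo : IdxExpr (Fin 8)} {s : MState K (X ⊕ Fin 8)}
    (hh : ∀ ρ : Fin 8 → ℕ, (∀ r ≠ 5, ρ r = s.own r) → eh.eval n ρ = h)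
    (hd : ∀ ρ : Fin 8 → ℕ, (∀ r ≠ 5, ρ r = s.own r) → ed.eval n ρ = b + m)
    (hv' : ev.eval n s.own = b')
    (ho : ∀ ρ : Fin 8 → ℕ, (∀ r ≠ 5, ρ r = s.own r) → eo.eval n ρ = o)
    (hbound : A.ptrFactor * (h + 1) ≤ bound) (hpos : 1 ≤ h) (hhb : h ≤ bound)
    (htot : o + h + A.work h ≤ 3 * n) (hnb : n ≤ b) (hm : b + m + h ≤ o) (hb' : b' + h ≤ o)
    {f g q v : ℕ → K} (hq : IsQuot f g q) (hgv : IsQuot (fun i => if i = 0 then 1 else 0) g v)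
    (hf : s.Holds (b + m) h (fun x => remainder f g q m (m + x))) (hv : s.Holds b' h v) :
    Runs (divMachine n bound) (scaleBlock A ι eh ed ev eo) s (T h) (fun s' =>
      (∀ r ≠ 5, s'.own r = s.own r) ∧
      s'.Holds (b + m) h (fun x => q (m + x)) ∧
      ∀ c, (c < b + m ∨ b + m + h ≤ c) → (c < o ∨ c = 3 * n) → s'.mem c = s.mem c) := by
  refine Runs.seq' (T₂ := 0) (runs_shortCall hA hι (hh _ fun _ _ => rfl) (hd _ fun _ _ => rfl) hv'
    (ho _ fun _ _ => rfl) hbound hpos htot (by omega) hm hb' hf hv) ?_ (add_zero _).le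
  rintro s₁ ⟨hown, hfr, hout⟩
  refine (runs_pass (m := divMachine n bound) (d := b + m) (len := h) (tmp := 3 * n + 1)
    (w := fun x => .elem (q (m + x))) 0 hhb (by omega) ?_ ?_).mono (by simp) ?_
  · intro ρ hρ
    exact hh ρ fun r hr => by rw [hρ r hr, hown]
  · intro i hi st hst h5 hmem
    have hd' := hd st.own fun r hr => by rw [hst r hr, hown]
    have ho' := ho st.own fun r hr => by rw [hst r hr, hown]
    refine Runs.move ?_ ?_ ?_
    · simp only [MState.val_up, divMachine, Machine.Writable, IdxExpr.eval_add,
        IdxExpr.eval_reg, hd', h5]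
      omega
    · simp only [MState.val_up, divMachine, Machine.Readable, IdxExpr.eval_add,
        IdxExpr.eval_reg, ho', h5]
      omega
    · simp only [MState.val_up, divMachine, IdxExpr.eval_add, IdxExpr.eval_reg, hd', ho', h5,
        MState.own_write]
      refine ⟨trivial, ?_, fun c hc _ => by rw [MState.mem_write, if_neg hc]⟩
      rw [MState.mem_write, if_pos rfl, hmem _ (by omega) (by omega), hout i hi]
      exact congrArg _ (hq.sum_remainder_mul hgv m i)
  · rintro s₂ ⟨hown₂, hw, hm₂⟩
    refine ⟨fun r hr => by rw [hown₂ r hr, hown], fun i hi => hw i hi, fun c hc hc' => ?_⟩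
    rw [hm₂ c hc (by omega), hfr c (by omega)]

/-! ### Newton iteration for the inverse of the divisor -/

/-- The address of the inverse, for `B` blocks. -/
def invAddr (B : ℕ) : IdxExpr (Fin 8) := .size + .const B * .reg 1

/-- The address of the scratch area, for `B` blocks. -/
def scratchAddr (B : ℕ) : IdxExpr (Fin 8) := .size + .const B * .reg 1 + .reg 1

/-- Newton iteration, doubling the precision in register `2` up to that in register `1`. -/
def newton (MP SP : Algorithm K) (ιm : Fin MP.numIdx → X) (ιs : Fin SP.numIdx → X) (B : ℕ) :
    Prog K (X ⊕ Fin 8) :=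
  .loop (IdxExpr.reg 1 - .reg 2).up
    (.seq (updateBlock MP ιm (.reg 2) 1 (invAddr B) (invAddr B + .reg 2) (scratchAddr B))
      (.seq (scaleBlock SP ιs (.reg 2) (invAddr B + .reg 2) (invAddr B) (scratchAddr B))
        (.setIdx (.inr 2) (.up (2 * .reg 2)))))

/-- The block loop: for each of the `B` blocks of the dividend, subtract the contributions of the
preceding blocks of the quotient and multiply by the inverse. -/
def blockLoop (MP SP : Algorithm K) (ιm : Fin MP.numIdx → X) (ιs : Fin SP.numIdx → X) (B : ℕ) :
    Prog K (X ⊕ Fin 8) :=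
  forUp 3 (.const B)
    (.seq (forUp 4 (.reg 3) (updateBlock MP ιm (.reg 1) ((.reg 3 - .reg 4 - 1) * .reg 1 + 1)
      (.size + .reg 4 * .reg 1) (.size + .reg 3 * .reg 1) (scratchAddr B)))
      (scaleBlock SP ιs (.reg 1) (.size + .reg 3 * .reg 1) (invAddr B) (scratchAddr B)))

variable {MP SP : Algorithm K} {Tm Ts : ℕ → ℝ} {ιm : Fin MP.numIdx → X} {ιs : Fin SP.numIdx → X}
  {n bound k B : ℕ} {s : MState K (X ⊕ Fin 8)} {f g q v : ℕ → K} {x y : ℝ}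

/-- With dividend 1, a step at precision h is a block update with m = 0, D = h, x₁ = 1, followed by
scaling with the part of `v` already known. The zeros stored beyond the current precision are the
coefficients of the dividend 1 there, so the update turns them directly into the remainder. -/
theorem runs_newton (hMP : ComputesMiddleProduct MP Tm) (hSP : ComputesShortProduct SP Ts)
    (hιm : ιm.Injective) (hιs : ιs.Injective) {a j : ℕ} (ha : 1 ≤ a) (hk : k = a * 2 ^ j)
    (hbm : MP.ptrFactor * (k + 1) ≤ bound) (hbs : SP.ptrFactor * (k + 1) ≤ bound)
    (hkb : k ≤ bound)
    (hwm : ∀ h, 1 ≤ h → h ≤ k → n + B * k + k + h + MP.work h ≤ 3 * n)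
    (hws : ∀ h, 1 ≤ h → h ≤ k → n + B * k + k + h + SP.work h ≤ 3 * n)
    (hTm : ∀ h, 1 ≤ h → h ≤ k → Tm h + h ≤ x * h) (hTs : ∀ h, 1 ≤ h → h ≤ k → Ts h ≤ y * h)
    (hx : 0 ≤ x) (hy : 0 ≤ y)
    (hgv : IsQuot (fun i => if i = 0 then 1 else 0) g v)
    (hg : ∀ i < n, s.mem i = .elem (g i)) (hg0 : ∀ i, n ≤ i → g i = 0)
    (hz : s.mem (3 * n) = .elem 0) (h1 : s.own 1 = k) (h2 : s.own 2 = a)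
    (hv : ∀ i < k, s.mem (n + B * k + i) = .elem (if i < a then v i else 0)) :
    Runs (divMachine n bound) (newton MP SP ιm ιs B) s ((x + y) * k) (fun s' =>
      s'.own 1 = k ∧ s'.Holds (n + B * k) k v ∧
      ∀ c, c < n + B * k ∨ c = 3 * n → s'.mem c = s.mem c) := by
  have hpow : ∀ i, i ≤ j → a * 2 ^ i ≤ k := fun i hi => by
    rw [hk]
    exact Nat.mul_le_mul_left _ (Nat.pow_le_pow_right (by norm_num) hi)
  refine (Runs.loop (fun i st => st.own 1 = k ∧ st.own 2 = a * 2 ^ i ∧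
    (∀ t < k, st.mem (n + B * k + t) = .elem (if t < a * 2 ^ i then v t else 0)) ∧
    ∀ c, c < n + B * k ∨ c = 3 * n → st.mem c = s.mem c) j (fun i => (x + y) * (a * 2 ^ i : ℕ))
    ?_ ?_ ⟨h1, by simpa using h2, by simpa using hv, fun _ _ => rfl⟩).mono ?_ ?_
  · rintro i hi st ⟨st1, st2, stv, hfr⟩
    have hlt : 2 * (a * 2 ^ i) ≤ k := by
      have := hpow (i + 1) hi
      rw [pow_succ] at this
      linarith
    have hpos : 1 ≤ a * 2 ^ i := Nat.mul_pos ha (by positivity)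
    have hsucc : a * 2 ^ (i + 1) = 2 * (a * 2 ^ i) := by ring
    rw [hsucc]
    generalize a * 2 ^ i = h at *
    have hwm' := hwm h hpos (by omega)
    have hws' := hws h hpos (by omega)
    have hTm' := hTm h hpos (by omega)
    have hTs' := hTs h hpos (by omega)
    have hbm' : MP.ptrFactor * (h + 1) ≤ bound :=
      (Nat.mul_le_mul_left _ (by omega)).trans hbm
    have hbs' : SP.ptrFactor * (h + 1) ≤ bound :=
      (Nat.mul_le_mul_left _ (by omega)).trans hbs
    refine ⟨by simp [st1, st2]; omega, ?_⟩
    refine Runs.seq' (T₁ := Tm h + h) (T₂ := Ts h)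
      (runs_updateBlock hMP hιm (b := n + B * k) (m := 0) (D := h) (x₁ := 1) (h := h)
      (o := n + B * k + k) (f := fun i => if i = 0 then 1 else 0) (g := g) (q := v)
      ?_ (by simp) ?_ ?_ ?_ hbm' hpos (by omega) hwm' (by omega) (by omega) (by omega) (by omega)
      ?_ hg0 ?_ ?_ ?_) ?_ (by linarith)
    · intro ρ hρ
      simpa [hρ] using st2
    · simp [invAddr, st1]
    · intro ρ hρ
      simp [hρ, st2, st1, invAddr]
    · intro ρ hρ
      simp [hρ, st1, scratchAddr]
    · intro t ht
      rw [hfr t (by omega), hg t ht]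
    · rw [hfr _ (Or.inr rfl), hz]
    · intro t ht
      beta_reduce
      rw [add_zero, stv t (by omega), if_pos ht, zero_add]
    · intro t ht
      beta_reduce
      rw [add_assoc (n + B * k), stv _ (by omega), if_neg (by omega), remainder_zero,
        if_neg (by omega)]
    · rintro s₁ ⟨hown₁, hout₁, hfr₁⟩
      rw [zero_add] at hout₁
      refine Runs.seq' (T₂ := 0) (runs_scaleBlock hSP hιs (b := n + B * k) (m := h)
        (b' := n + B * k) (h := h) (o := n + B * k + k) ?_ ?_ ?_ ?_ hbs' hpos (by omega) hws'
        (by omega) (by omega) (by omega) hgv hgv hout₁ ?_) ?_ (by simp)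
      · intro ρ hρ
        simpa [hρ, hown₁] using st2
      · intro ρ hρ
        simp [hρ, hown₁, st2, st1, invAddr]
      · simp [invAddr, hown₁, st1]
      · intro ρ hρ
        simp [hρ, hown₁, st1, scratchAddr]
      · intro t ht
        rw [hfr₁ _ (by omega) (by omega), stv t (by omega), if_pos ht]
      · rintro s₂ ⟨hown₂, hout₂, hfr₂⟩
        have h22 : s₂.own 2 = h := by
          rw [hown₂ 2 (by decide), hown₁ 2 (by decide), st2]
        refine Runs.setIdx ?_ ?_
        · simp only [MState.val_up, divMachine, IdxExpr.eval_mul, IdxExpr.eval_ofNat,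
            IdxExpr.eval_reg, h22]
          omega
        · refine ⟨?_, ?_, ?_, ?_⟩
          · simp [hown₂, hown₁, st1]
          · simp [h22]
          · intro t ht
            rw [MState.mem_setIdx]
            by_cases hth : t < h
            · rw [hfr₂ _ (by omega) (by omega), hfr₁ _ (by omega) (by omega), stv t ht, if_pos hth,
                if_pos (by omega)]
            · by_cases hth2 : t < 2 * h
              · have := hout₂ (t - h) (by omega)
                beta_reduce at this
                rw [show n + B * k + h + (t - h) = n + B * k + t by omega,
                  show h + (t - h) = t by omega] at this
                rw [this, if_pos hth2]
              · rw [hfr₂ _ (by omega) (by omega), hfr₁ _ (by omega) (by omega), stv t ht,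
                  if_neg hth, if_neg hth2]
          · intro c hc
            rw [MState.mem_setIdx, hfr₂ _ (by omega) (by omega), hfr₁ _ (by omega) (by omega),
              hfr c hc]
  · rintro st ⟨st1, st2, -⟩
    simp [st1, st2, hk]
  · rw [← Finset.mul_sum]
    refine mul_le_mul_of_nonneg_left ?_ (add_nonneg hx hy)
    rw [← Nat.cast_sum]
    norm_cast
    rw [← Finset.mul_sum, hk]
    refine Nat.mul_le_mul_left _ ?_
    rw [Nat.geomSum_eq le_rfl]
    simp
  · rintro st ⟨st1, -, stv, hfr⟩
    refine ⟨st1, fun t ht => ?_, hfr⟩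
    rw [stv t ht, if_pos (by omega)]

/-- Quotient blocks replace dividend blocks from left to right. Block i costs i updates and one
scaling, and summing i over i < B gives B(B-1)/2. -/
theorem runs_blockLoop (hMP : ComputesMiddleProduct MP Tm) (hSP : ComputesShortProduct SP Ts)
    (hιm : ιm.Injective) (hιs : ιs.Injective) (hk : 1 ≤ k)
    (hbm : MP.ptrFactor * (k + 1) ≤ bound) (hbs : SP.ptrFactor * (k + 1) ≤ bound)
    (hkb : k ≤ bound) (hB : B ≤ bound)
    (hwm : n + B * k + k + k + MP.work k ≤ 3 * n) (hws : n + B * k + k + k + SP.work k ≤ 3 * n)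
    (hTm : Tm k + k ≤ x * k) (hTs : Ts k ≤ y * k)
    (hq : IsQuot f g q) (hgv : IsQuot (fun i => if i = 0 then 1 else 0) g v)
    (hg : ∀ i < n, s.mem i = .elem (g i)) (hg0 : ∀ i, n ≤ i → g i = 0)
    (hz : s.mem (3 * n) = .elem 0) (h1 : s.own 1 = k)
    (hf : s.Holds n (B * k) f) (hv : s.Holds (n + B * k) k v) :
    Runs (divMachine n bound) (blockLoop MP SP ιm ιs B) s
      (x * k * (B * (B - 1) / 2) + y * k * B) (fun s' => s'.Holds n (B * k) q) := by
  refine (runs_forUp (fun i => i * (x * k) + y * k) (fun i st => i ≤ B ∧ st.own 3 = i ∧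
    st.own 1 = k ∧ (∀ t < i * k, st.mem (n + t) = .elem (q t)) ∧
    (∀ t, i * k ≤ t → t < B * k → st.mem (n + t) = .elem (f t)) ∧
    ∀ c, c < n ∨ c = 3 * n ∨ (n + B * k ≤ c ∧ c < n + B * k + k) → st.mem c = s.mem c) (len := B)
    hB ?_ ?_ ?_).mono ?_ ?_
  · exact ⟨Nat.zero_le _, by simp, by simp [h1], by simp, fun t _ ht => hf t ht, fun _ _ => rfl⟩
  · rintro i st ⟨-, h3, -⟩
    exact ⟨h3, rfl⟩
  · rintro i hi st ⟨-, st3, st1, stq, stf, hfr⟩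
    have hiB : i * k + k ≤ B * k := by
      rw [← Nat.succ_mul]
      exact Nat.mul_le_mul_right _ hi
    refine Runs.seq' (T₁ := i * (x * k)) (T₂ := y * k)
      (R := fun st' => st'.own 3 = i ∧ st'.own 1 = k ∧
        st'.Holds (n + i * k) k (fun t => remainder f g q (i * k) (i * k + t)) ∧
        ∀ c, (c < n + i * k ∨ n + i * k + k ≤ c) → (c < n + B * k + k ∨ c = 3 * n) →
          st'.mem c = st.mem c) ?_ ?_ le_rfl
    · refine (runs_forUp (fun _ => x * k) (fun j st' => j ≤ i ∧ st'.own 4 = j ∧ st'.own 3 = i ∧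
        st'.own 1 = k ∧
        st'.Holds (n + i * k) k (fun t => remainder f g q (j * k) (i * k + t)) ∧
        ∀ c, (c < n + i * k ∨ n + i * k + k ≤ c) → (c < n + B * k + k ∨ c = 3 * n) →
          st'.mem c = st.mem c) (len := i) (by simp only [divMachine]; omega)
          ?_ ?_ ?_).mono ?_ ?_
      · refine ⟨Nat.zero_le _, by simp, by simp [st3], by simp [st1], fun t ht => ?_,
          fun _ _ _ => rfl⟩
        beta_reduce
        rw [MState.mem_setIdx, add_assoc, stf _ (by omega) (by omega), zero_mul, remainder_zero]
      · rintro j st' ⟨-, h4, h3, -⟩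
        exact ⟨h4, by simp [h3]⟩
      · rintro j hj st' ⟨-, st4', st3', st1', hrem, hfr'⟩
        -- This is the alignment D + 1 = m + x₁ + h required by the update, for D = ik, m = jk and h
        -- = k.
        have hji : j * k + k + (i - j - 1) * k = i * k := by
          rw [← Nat.succ_mul, ← Nat.add_mul]
          congr 1
          omega
        refine (runs_updateBlock hMP hιm (b := n) (m := j * k) (D := i * k)
          (x₁ := (i - j - 1) * k + 1) (h := k) (o := n + B * k + k) (f := f) (g := g) (q := q)
          ?_ ?_ ?_ ?_ ?_ hbm hk hkb hwm le_rfl (by omega) (by omega) (by omega) ?_ hg0 ?_ ?_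
          hrem).mono hTm ?_
        · intro ρ hρ
          simp [hρ, st1']
        · simp [st3', st4', st1']
        · simp [st4', st1']
        · intro ρ hρ
          simp [hρ, st3', st1']
        · intro ρ hρ
          simp [hρ, st1', scratchAddr]
        · intro t ht
          rw [hfr' t (by omega) (by omega), hfr t (by omega), hg t ht]
        · rw [hfr' _ (by omega) (by omega), hfr _ (by omega), hz]
        · intro t ht
          rw [hfr' _ (by omega) (by omega), add_assoc, stq _ (by omega)]
        · rintro s₂ ⟨hown, hout, hfr₂⟩
          refine ⟨by rw [hown 4 (by decide), st4'], hj, by simp, ?_, ?_, ?_, ?_⟩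
          · simp [hown, st3']
          · simp [hown, st1']
          · intro t ht
            rw [MState.mem_setIdx, hout t ht, Nat.succ_mul]
          · intro c hc hc'
            rw [MState.mem_setIdx, hfr₂ c hc hc', hfr' c hc hc']
      · simp
      · rintro st' ⟨-, -, a, b, c, d⟩
        exact ⟨a, b, c, d⟩
    · rintro st' ⟨st3', st1', hrem, hfr'⟩
      refine (runs_scaleBlock hSP hιs (b := n) (m := i * k) (b' := n + B * k) (h := k)
        (o := n + B * k + k) ?_ ?_ ?_ ?_ hbs hk hkb hws le_rfl (by omega) (by omega) hq hgv
        hrem ?_).mono hTs ?_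
      · intro ρ hρ
        simp [hρ, st1']
      · intro ρ hρ
        simp [hρ, st3', st1']
      · simp [invAddr, st1']
      · intro ρ hρ
        simp [hρ, st1', scratchAddr]
      · intro t ht
        rw [hfr' _ (by omega) (by omega), hfr _ (by omega), hv t ht]
      · rintro s₂ ⟨hown, hout, hfr₂⟩
        refine ⟨by rw [hown 3 (by decide), st3'], hi, by simp, ?_, ?_, ?_, ?_⟩
        · simp [hown, st1']
        · intro t ht
          rw [Nat.succ_mul] at ht
          rw [MState.mem_setIdx]
          by_cases hti : t < i * k
          · rw [hfr₂ _ (by omega) (by omega), hfr' _ (by omega) (by omega), stq t hti]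
          · have := hout (t - i * k) (by omega)
            beta_reduce at this
            rwa [show n + i * k + (t - i * k) = n + t by omega,
              show i * k + (t - i * k) = t by omega] at this
        · intro t ht ht'
          rw [Nat.succ_mul] at ht
          rw [MState.mem_setIdx, hfr₂ _ (by omega) (by omega), hfr' _ (by omega) (by omega),
            stf t (by omega) ht']
        · intro c hc
          rw [MState.mem_setIdx, hfr₂ _ (by omega) (by omega), hfr' _ (by omega) (by omega),
            hfr c hc]
  · rw [Finset.sum_add_distrib, ← Finset.sum_mul, Finset.sum_const, Finset.card_range]
    have : ∀ B : ℕ, (∑ i ∈ Finset.range B, (i : ℝ)) = B * (B - 1) / 2 := by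
      intro B
      induction B with
      | zero => simp
      | succ B ih =>
        rw [Finset.sum_range_succ, ih]
        push_cast
        ring
    rw [this, nsmul_eq_mul]
    linarith
  · rintro st ⟨-, -, -, h, -⟩
    exact h

end Blocks

/-! ### The division program -/

section Division

variable {K : Type*} [CommRing K] {X : Type} [DecidableEq X]

/-- Chooses the block size (register `1`) as a power of `2` times the initial precision
(register `2`). -/
def chooseSizes (A B : ℕ) : Prog K (X ⊕ Fin 8) :=
  .seq (.setIdx (.inr 0) (IdxExpr.up 1))
    (.seq (.loop (IdxExpr.size + 1 - .const (2 * A * B) * .reg 0).up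
        (.setIdx (.inr 0) (.up (2 * .reg 0))))
      (.seq (.setIdx (.inr 2) (.up ((.size + .const B * .reg 0 - 1) / (.const B * .reg 0))))
        (.setIdx (.inr 1) (.up (.reg 2 * .reg 0)))))

/-- Take the least power p = 2^j with 2ABp > n, so that ABp ≤ n, and a = ⌈n / (Bp)⌉. Then a ≤ 2A,
and rounding up costs Bk - n ≤ Bp ≤ n/A. -/
theorem runs_chooseSizes {A B n bound : ℕ} (hA : 1 ≤ A) (hB : 2 ≤ B) (hn : 2 * A * B ≤ n)
    (hbound : 2 * n ≤ bound) (s : MState K (X ⊕ Fin 8)) :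
    Runs (divMachine n bound) (chooseSizes A B) s 0 (fun st => st.mem = s.mem ∧
      ∃ a j k, 1 ≤ a ∧ a ≤ 2 * A ∧ k = a * 2 ^ j ∧ st.own 1 = k ∧ st.own 2 = a ∧
        n ≤ B * k ∧ A * (B * k) ≤ (A + 1) * n) := by
  have hX : 1 ≤ 2 * A * B := Nat.mul_pos (by omega) (by omega)
  have hAB : A ≤ A * B := Nat.le_mul_of_pos_right _ (by omega)
  have hex : ∃ j, n < 2 * A * B * 2 ^ j :=
    ⟨n, n.lt_two_pow_self.trans_le (Nat.le_mul_of_pos_left _ hX)⟩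
  obtain ⟨j, hj, hmin⟩ : ∃ j, n < 2 * A * B * 2 ^ j ∧ ∀ i < j, 2 * A * B * 2 ^ i ≤ n :=
    ⟨Nat.find hex, Nat.find_spec hex, fun i hi => not_lt.mp (Nat.find_min hex hi)⟩
  -- The case j = 0 contradicts 2AB ≤ n; otherwise this is the failure of the condition at j - 1.
  have hj2 : A * B * 2 ^ j ≤ n := by
    cases j with
    | zero => rw [pow_zero] at hj; omega
    | succ j =>
      have := hmin j (Nat.lt_succ_self j)
      rw [pow_succ]
      linarith
  have hle : ∀ i ≤ j, 2 ^ i ≤ n := fun i hi =>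
    (Nat.pow_le_pow_right (by norm_num) hi).trans
      ((Nat.le_mul_of_pos_left _ (Nat.mul_pos hA (by omega))).trans hj2)
  refine Runs.seq' (T₁ := 0) (T₂ := 0) (R := fun st => st.mem = s.mem ∧ st.own 0 = 1)
    (Runs.setIdx (by simp [divMachine]; omega) (by simp)) ?_ (by simp)
  rintro s₁ ⟨hm₁, hp₁⟩
  refine Runs.seq' (T₁ := 0) (T₂ := 0) (R := fun st => st.mem = s.mem ∧ st.own 0 = 2 ^ j)
    ((Runs.loop (fun i st => st.mem = s.mem ∧ st.own 0 = 2 ^ i) j (fun _ => 0) ?_ ?_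
      ⟨hm₁, by simpa using hp₁⟩).mono (by simp) fun _ h => h) ?_ (by simp)
  · rintro i hi st ⟨hm, hp⟩
    have h1 := hmin i hi
    have h2 := hle (i + 1) hi
    refine ⟨?_, Runs.setIdx ?_ ⟨hm, ?_⟩⟩
    · simp only [MState.val_up, divMachine, IdxExpr.eval_add, IdxExpr.eval_mul, IdxExpr.eval_sub,
        IdxExpr.eval_size, IdxExpr.eval_const, IdxExpr.eval_reg, IdxExpr.eval_ofNat, hp]
      omega
    · simp only [MState.val_up, divMachine, IdxExpr.eval_mul, IdxExpr.eval_reg,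
        IdxExpr.eval_ofNat, hp]
      rw [pow_succ] at h2
      omega
    · simp [hp, pow_succ, mul_comm]
  · rintro st ⟨-, hp⟩
    simp only [MState.val_up, divMachine, IdxExpr.eval_add, IdxExpr.eval_mul, IdxExpr.eval_sub,
      IdxExpr.eval_size, IdxExpr.eval_const, IdxExpr.eval_reg, IdxExpr.eval_ofNat, hp]
    omega
  rintro s₂ ⟨hm₂, hp₂⟩
  generalize hp : 2 ^ j = p at *
  have hp1 : 1 ≤ p := hp ▸ Nat.one_le_two_pow
  have hd : 1 ≤ B * p := Nat.mul_pos (by omega) hp1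
  obtain ⟨a, ha⟩ : ∃ a, a = (n + B * p - 1) / (B * p) := ⟨_, rfl⟩
  have ha1 : a * (B * p) ≤ n + B * p - 1 := ha ▸ Nat.div_mul_le_self _ _
  have ha2 : n + B * p - 1 < B * p * (a + 1) := by rw [ha]; exact Nat.lt_mul_div_succ _ hd
  have hnk : n ≤ a * (B * p) := by
    have : B * p * (a + 1) = a * (B * p) + B * p := by ring
    omega
  have haA : a ≤ 2 * A := by
    have h1 : a * (B * p) < (2 * A + 1) * (B * p) := by
      have : 2 * A * B * p = 2 * A * (B * p) := by ring
      rw [add_mul, one_mul]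
      omega
    exact Nat.lt_succ_iff.mp (Nat.lt_of_mul_lt_mul_right h1)
  have hapos : 1 ≤ a := by
    rcases Nat.eq_zero_or_pos a with rfl | h
    · omega
    · exact h
  have hBk : B * (a * p) = a * (B * p) := by ring
  have hABk : A * (B * (a * p)) ≤ (A + 1) * n := by
    have h1 : B * (a * p) ≤ n + B * p := by omega
    calc A * (B * (a * p)) ≤ A * (n + B * p) := Nat.mul_le_mul_left _ h1
      _ = A * n + A * B * p := by ring
      _ ≤ (A + 1) * n := by rw [add_mul, one_mul]; omega
  have hkn : a * p ≤ n := by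
    have h1 : 2 * (a * p) ≤ B * (a * p) := Nat.mul_le_mul_right _ hB
    have h2 : A * (B * (a * p)) ≤ A * (2 * n) := by nlinarith
    have := Nat.le_of_mul_le_mul_left h2 hA
    omega
  have hae : (n + B * p - 1) / (B * p) = a := ha.symm
  have h2AB : 2 * A ≤ n := by
    have : 2 * A * B = 2 * (A * B) := by ring
    omega
  refine Runs.seq' (T₁ := 0) (T₂ := 0)
    (R := fun st => st.mem = s.mem ∧ st.own 0 = p ∧ st.own 2 = a) (Runs.setIdx ?_ ?_) ?_ (by simp)
  · simp only [MState.val_up, divMachine, IdxExpr.eval_add, IdxExpr.eval_mul, IdxExpr.eval_sub,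
      IdxExpr.eval_div, IdxExpr.eval_size, IdxExpr.eval_const, IdxExpr.eval_reg,
      IdxExpr.eval_ofNat, hp₂, hae]
    omega
  · refine ⟨hm₂, by simp [hp₂], ?_⟩
    simp [divMachine, hp₂, hae]
  rintro s₃ ⟨hm₃, hp₃, ha₃⟩
  refine Runs.setIdx ?_ ?_
  · simp only [MState.val_up, divMachine, IdxExpr.eval_mul, IdxExpr.eval_reg, hp₃, ha₃]
    omega
  · exact ⟨hm₃, a, j, a * p, hapos, haA, by rw [hp], by simp [hp₃, ha₃], by simp [ha₃],
      by rw [hBk]; exact hnk, hABk⟩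

/-- Division by blocks: the quotient replaces the dividend. -/
def blockDiv (MP SP : Algorithm K) (ιm : Fin MP.numIdx → X) (ιs : Fin SP.numIdx → X) (A B : ℕ) :
    Prog K (X ⊕ Fin 8) :=
  .seq (chooseSizes A B)
    (.seq (.const (IdxExpr.up (3 * .size)) 0)
      (.seq (forUp 5 (scratchAddr B - 2 * .size) (.const (.up (2 * .size + .reg 5)) 0))
        (.seq (.const (invAddr B).up 1)
          (.seq (naiveDiv (invAddr B) (.reg 2))
            (.seq (newton MP SP ιm ιs B) (blockLoop MP SP ιm ιs B))))))

/-- Memory is laid out as the divisor in [0, n), the dividend and later the quotient, padded to Bk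
coefficients, from n on, then the inverse in k registers, then scratch up to 3n. The hypothesis
`hspace` says that every product call fits. Address 3n holds zero and 3n + 1 is temporary. -/
theorem runs_blockDiv {MP SP : Algorithm K} {Tm Ts : ℕ → ℝ}
    (hMP : ComputesMiddleProduct MP Tm) (hSP : ComputesShortProduct SP Ts)
    {ιm : Fin MP.numIdx → X} {ιs : Fin SP.numIdx → X} (hιm : ιm.Injective) (hιs : ιs.Injective)
    {A B n bound : ℕ} (hA : 1 ≤ A) (hB : 2 ≤ B) (hn : 2 * A * B ≤ n) (hbound : 2 * n ≤ bound)
    (hbm : MP.ptrFactor * (n + 1) ≤ bound) (hbs : SP.ptrFactor * (n + 1) ≤ bound)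
    {x y T : ℝ} (hx : 0 ≤ x) (hy : 0 ≤ y)
    (hTm : ∀ h, 1 ≤ h → h ≤ n → Tm h + h ≤ x * h) (hTs : ∀ h, 1 ≤ h → h ≤ n → Ts h ≤ y * h)
    (hspace : ∀ k, A * (B * k) ≤ (A + 1) * n → ∀ h, 1 ≤ h → h ≤ k →
      n + B * k + k + h + MP.work h ≤ 3 * n ∧ n + B * k + k + h + SP.work h ≤ 3 * n)
    (hT : ∀ k : ℕ, A * (B * k) ≤ (A + 1) * n →
      8 * A ^ 2 + (x + y) * k + (x * k * (B * (B - 1) / 2) + y * k * B) ≤ T)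
    {f g q v : ℕ → K} (hu : IsUnit (g 0))
    (hq : IsQuot f g q) (hgv : IsQuot (fun i => if i = 0 then 1 else 0) g v)
    (hg0 : ∀ i, n ≤ i → g i = 0) (hf0 : ∀ i, n ≤ i → f i = 0)
    {s : MState K (X ⊕ Fin 8)} (hg : s.Holds 0 n g) (hf : s.Holds n n f) :
    Runs (divMachine n bound) (blockDiv MP SP ιm ιs A B) s T (fun st => st.Holds n n q) := by
  refine Runs.seq' (T₁ := 0) (T₂ := T) (runs_chooseSizes hA hB hn hbound s) ?_ (zero_add _).le
  rintro s₁ ⟨hm₁, a, j, k, ha, haA, hk, h1, h2, hnk, hABk⟩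
  have hak : a ≤ k := hk ▸ Nat.le_mul_of_pos_right _ (by positivity)
  have hspace' := hspace k hABk k (by omega) le_rfl
  have hTk := hT k hABk
  have hkn : k ≤ n := by omega
  have hlen : n + B * k + k - 2 * n ≤ n := by omega
  refine Runs.seq' (T₁ := 0) (T₂ := T) (R := fun st => st = s₁.write (3 * n) (.elem 0))
    (Runs.const (by simp [divMachine, Machine.Writable]; omega) (by simp [divMachine])) ?_
    (zero_add _).le
  rintro s₂ rfl
  -- One pass of zeros serves twice: it pads the dividend from n to Bk coefficients, and with the 1
  -- written next it puts the series 1 into the area of the inverse.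
  refine Runs.seq' (T₁ := 0) (T₂ := T) ((runs_pass (m := divMachine n bound) (d := 2 * n)
    (len := n + B * k + k - 2 * n) (tmp := 3 * n + 1) (w := fun _ => .elem 0) 0
    (by simp only [divMachine]; omega) (by omega) ?_ ?_).mono (by simp) fun _ h => h) ?_
    (zero_add _).le
  · intro ρ hρ
    simp [divMachine, scratchAddr, hρ, h1]
  · intro i hi st hst h5 hm
    refine Runs.const ?_ ?_
    · simp only [MState.val_up, divMachine, Machine.Writable, IdxExpr.eval_add, IdxExpr.eval_mul,
        IdxExpr.eval_size, IdxExpr.eval_reg, IdxExpr.eval_ofNat, h5]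
      omega
    · simp only [MState.val_up, divMachine, IdxExpr.eval_add, IdxExpr.eval_mul,
        IdxExpr.eval_size, IdxExpr.eval_reg, IdxExpr.eval_ofNat, h5]
      exact ⟨rfl, by simp [MState.mem_write], fun b hb _ => by rw [MState.mem_write, if_neg hb]⟩
  rintro s₃ ⟨hown₃, hw₃, hm₃⟩
  have h13 : s₃.own 1 = k := by rw [hown₃ 1 (by decide)]; exact h1
  have h23 : s₃.own 2 = a := by rw [hown₃ 2 (by decide)]; exact h2
  have hs₃ : ∀ b < 2 * n, s₃.mem b = s.mem b := by
    intro b hb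
    rw [hm₃ b (by omega) (by omega), MState.mem_write, if_neg (by omega), hm₁]
  have hz₃ : s₃.mem (3 * n) = .elem 0 := by
    rw [hm₃ _ (by omega) (by omega), MState.mem_write, if_pos rfl]
  have hw₃' : ∀ b, 2 * n ≤ b → b < n + B * k + k → s₃.mem b = .elem 0 := by
    intro b hb hb'
    have := hw₃ (b - 2 * n) (by omega)
    rwa [show 2 * n + (b - 2 * n) = b by omega] at this
  refine Runs.seq' (T₁ := 0) (T₂ := T) (R := fun st => st = s₃.write (n + B * k) (.elem 1))
    (Runs.const ?_ (by simp [divMachine, invAddr, h13])) ?_ (zero_add _).le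
  · simp only [MState.val_up, divMachine, Machine.Writable, invAddr, IdxExpr.eval_add,
      IdxExpr.eval_mul, IdxExpr.eval_size, IdxExpr.eval_reg, IdxExpr.eval_const, h13]
    omega
  rintro s₄ rfl
  refine Runs.seq' (T₁ := (2 * a ^ 2 : ℕ))
    (T₂ := (x + y) * k + (x * k * (B * (B - 1) / 2) + y * k * B))
    (runs_naiveDiv (b₀ := n + B * k) (L := a) hgv hu ?_ ?_ (by omega) (by omega) (by omega)
      (by omega) ?_ ?_) ?_ ?_
  · intro ρ hρ
    simp [invAddr, hρ, h13]
  · intro ρ hρ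
    simp [hρ, h23]
  · intro i hi
    rw [MState.mem_write, if_neg (by omega), hs₃ i (by omega)]
    simpa using hg i hi
  · intro i hi
    rw [MState.mem_write]
    rcases Nat.eq_zero_or_pos i with rfl | h
    · simp
    · simp only [if_neg (show ¬n + B * k + i = n + B * k by omega), if_neg h.ne']
      exact hw₃' _ (by omega) (by omega)
  · rintro s₅ ⟨hown₅, hv₅, hm₅⟩
    have h15 : s₅.own 1 = k := by rw [hown₅ 1 (by decide) (by decide)]; exact h13
    have h25 : s₅.own 2 = a := by rw [hown₅ 2 (by decide) (by decide)]; exact h23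
    have hg₅ : ∀ i < n, s₅.mem i = .elem (g i) := by
      intro i hi
      rw [hm₅ i (by omega) (by omega), MState.mem_write, if_neg (by omega), hs₃ i (by omega)]
      simpa using hg i hi
    have hz₅ : s₅.mem (3 * n) = .elem 0 := by
      rw [hm₅ _ (by omega) (by omega), MState.mem_write, if_neg (by omega), hz₃]
    have hf₅ : s₅.Holds n (B * k) f := by
      intro i hi
      rw [hm₅ _ (by omega) (by omega), MState.mem_write, if_neg (by omega)]
      by_cases hin : i < n
      · rw [hs₃ _ (by omega), hf i hin]
      · rw [hw₃' _ (by omega) (by omega), hf0 i (by omega)]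
    have hbm' : MP.ptrFactor * (k + 1) ≤ bound := (Nat.mul_le_mul_left _ (by omega)).trans hbm
    have hbs' : SP.ptrFactor * (k + 1) ≤ bound := (Nat.mul_le_mul_left _ (by omega)).trans hbs
    refine Runs.seq (runs_newton (a := a) (j := j) hMP hSP hιm hιs ha hk hbm' hbs' (by omega)
      (fun h hh hh' => (hspace k hABk h hh hh').1) (fun h hh hh' => (hspace k hABk h hh hh').2)
      (fun h hh hh' => hTm h hh (by omega)) (fun h hh hh' => hTs h hh (by omega)) hx hy hgv hg₅ hg0
      hz₅ h15 h25 ?_) ?_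
    · intro i hi
      split_ifs with hia
      · exact hv₅ i hia
      · rw [hm₅ _ (by omega) (by omega), MState.mem_write, if_neg (by omega),
          hw₃' _ (by omega) (by omega)]
    · rintro s₆ ⟨h16, hv₆, hm₆⟩
      have hBX : B ≤ 2 * A * B := Nat.le_mul_of_pos_left _ (by omega)
      refine (runs_blockLoop hMP hSP hιm hιs (by omega) hbm' hbs' (by omega) (by omega) hspace'.1
        hspace'.2 (hTm k (by omega) hkn) (hTs k (by omega) hkn) hq hgv ?_ hg0 ?_ h16 ?_ hv₆).mono
        le_rfl ?_
      · intro i hi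
        rw [hm₆ i (by omega), hg₅ i hi]
      · rw [hm₆ _ (Or.inr rfl), hz₅]
      · intro i hi
        rw [hm₆ _ (by omega), hf₅ i hi]
      · intro s₇ h i hi
        exact h i (by omega)
  · have h1 : ((2 * a ^ 2 : ℕ) : ℝ) ≤ 8 * A ^ 2 := by
      have : 2 * a ^ 2 ≤ 8 * A ^ 2 := by nlinarith
      exact_mod_cast this
    linarith

/-- Division of power series: the classical algorithm in sizes below `N`, division by blocks in
all other sizes. -/
def divProg (MP SP : Algorithm K) (ιm : Fin MP.numIdx → X) (ιs : Fin SP.numIdx → X) (A B N : ℕ) :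
    Prog K (X ⊕ Fin 8) :=
  .seq (.ite (IdxExpr.up (.const N - .size)) (naiveDiv .size .size) (blockDiv MP SP ιm ιs A B))
    (forUp 5 .size (.move (.up (2 * .size + .reg 5)) (.up (.size + .reg 5))))

theorem runs_divProg {MP SP : Algorithm K} {ιm : Fin MP.numIdx → X} {ιs : Fin SP.numIdx → X}
    {A B N n bound : ℕ} {T : ℝ} (hn : 1 ≤ n) (hbound : n ≤ bound)
    {f g q : ℕ → K} (hu : IsUnit (g 0)) (hq : IsQuot f g q)
    {s : MState K (X ⊕ Fin 8)} (hg : s.Holds 0 n g) (hf : s.Holds n n f)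
    (hsmall : n < N → (2 * n ^ 2 : ℕ) ≤ T)
    (hlarge : N ≤ n → Runs (divMachine n bound) (blockDiv MP SP ιm ιs A B) s T
      (fun st => st.Holds n n q)) :
    Runs (divMachine n bound) (divProg MP SP ιm ιs A B N) s T (fun st => st.Holds (2 * n) n q) := by
  refine Runs.seq' (T₂ := 0) (R := fun st => st.Holds n n q) (Runs.ite ?_ ?_) ?_ (add_zero _).le
  · intro h
    simp only [MState.val_up, divMachine, IdxExpr.eval_sub, IdxExpr.eval_size,
      IdxExpr.eval_const] at h
    refine (runs_naiveDiv hq hu (fun _ _ => rfl) (fun _ _ => rfl) le_rfl le_rfl (by omega)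
      hbound (fun i hi => by simpa using hg i hi) hf).mono (hsmall (by omega)) fun _ h => h.2.1
  · intro h
    simp only [MState.val_up, divMachine, IdxExpr.eval_sub, IdxExpr.eval_size,
      IdxExpr.eval_const] at h
    exact hlarge (by omega)
  · intro s₁ h₁
    refine (runs_pass (m := divMachine n bound) (d := 2 * n) (len := n) (tmp := 3 * n + 1)
      (w := fun i => .elem (q i)) 0 hbound (by omega) (fun _ _ => rfl) ?_).mono (by simp)
      fun _ h => h.2.1
    intro i hi st hst h5 hm
    refine Runs.move ?_ ?_ ?_
    · simp only [MState.val_up, divMachine, Machine.Writable, IdxExpr.eval_add, IdxExpr.eval_mul,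
        IdxExpr.eval_size, IdxExpr.eval_reg, IdxExpr.eval_ofNat, h5]
      omega
    · simp only [MState.val_up, divMachine, Machine.Readable, IdxExpr.eval_add,
        IdxExpr.eval_size, IdxExpr.eval_reg, h5]
      omega
    · simp only [MState.val_up, divMachine, IdxExpr.eval_add, IdxExpr.eval_mul,
        IdxExpr.eval_size, IdxExpr.eval_reg, IdxExpr.eval_ofNat, h5]
      refine ⟨rfl, ?_, fun b hb _ => by rw [MState.mem_write, if_neg hb]⟩
      rw [MState.mem_write, if_pos rfl, hm _ (by omega) (by omega), h₁ i hi]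

/-- The numbering of the index registers of erasing division. -/
def regEquiv (a b : ℕ) : (Fin a ⊕ Fin b) ⊕ Fin 8 ≃ Fin (a + b + 8) :=
  (Equiv.sumCongr finSumFinEquiv (Equiv.refl _)).trans finSumFinEquiv

/-- Erasing division of power series. -/
def erasingDivision (MP SP : Algorithm K) (A B N : ℕ) : Algorithm K where
  numIdx := MP.numIdx + SP.numIdx + 8
  prog := (divProg MP SP Sum.inl Sum.inr A B N).translate (regEquiv MP.numIdx SP.numIdx) .size id
  work _ := 2
  ptrFactor := MP.ptrFactor + SP.ptrFactor + 2

/-- The given series are cut off at n, which leaves the quotient mod X^n unchanged and makes the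
zero padding exact. The index registers are then renumbered by a translation that fixes all
addresses. -/
theorem computesErasingDivision {MP SP : Algorithm K} {A B N : ℕ} {T : ℕ → ℝ}
    (hsmall : ∀ n, 1 ≤ n → n < N → (2 * n ^ 2 : ℕ) ≤ T n)
    (hlarge : ∀ n bound, 1 ≤ n → N ≤ n → 2 * n ≤ bound → MP.ptrFactor * (n + 1) ≤ bound →
      SP.ptrFactor * (n + 1) ≤ bound → ∀ f g q v : ℕ → K, IsUnit (g 0) → IsQuot f g q →
      IsQuot (fun i => if i = 0 then 1 else 0) g v → (∀ i, n ≤ i → g i = 0) →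
      (∀ i, n ≤ i → f i = 0) →
      ∀ s : MState K ((Fin MP.numIdx ⊕ Fin SP.numIdx) ⊕ Fin 8), s.Holds 0 n g → s.Holds n n f →
      Runs (divMachine n bound) (blockDiv MP SP Sum.inl Sum.inr A B) s (T n)
        (fun st => st.Holds n n q)) :
    ComputesErasingDivision (erasingDivision MP SP A B N) T := by
  intro n hn F G hG s hsG hsF
  set g : ℕ → K := fun i => if i < n then PowerSeries.coeff i G else 0 with hg
  set f : ℕ → K := fun i => if i < n then PowerSeries.coeff i F else 0 with hf
  have hu : IsUnit (g 0) := by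
    rw [hg]
    simpa [Nat.pos_of_ne_zero (Nat.one_le_iff_ne_zero.mp hn)] using hG
  obtain ⟨q, hq⟩ := exists_isQuot f hu
  obtain ⟨v, hv⟩ := exists_isQuot (fun i => if i = 0 then 1 else 0) hu
  have hqe := hq.eq_coeff hG (n := n) (F := F) (fun i hi => if_pos hi) (fun i hi => if_pos hi)
  set bound := (MP.ptrFactor + SP.ptrFactor + 2) * (n + 1) with hbound
  have hb : bound = MP.ptrFactor * (n + 1) + SP.ptrFactor * (n + 1) + 2 * (n + 1) := by
    rw [hbound]; ring
  let e := regEquiv MP.numIdx SP.numIdx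
  have hgs : (⟨s.idx ∘ e, s.mem ∘ id⟩ :
      MState K ((Fin MP.numIdx ⊕ Fin SP.numIdx) ⊕ Fin 8)).Holds 0 n g := by
    intro i hi
    rw [hg]
    simpa [hi] using hsG i hi
  have hfs : (⟨s.idx ∘ e, s.mem ∘ id⟩ :
      MState K ((Fin MP.numIdx ⊕ Fin SP.numIdx) ⊕ Fin 8)).Holds n n f := by
    intro i hi
    rw [hf]
    simpa [hi] using hsF i hi
  have hrun := runs_divProg (MP := MP) (SP := SP) (ιm := Sum.inl) (ιs := Sum.inr) (A := A) (B := B)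
    (N := N) (bound := bound) hn (by omega) hu hq hgs hfs (hsmall n hn)
    (fun hN => hlarge n bound hn hN (by omega) (by omega) (by omega) f g q v hu hq hv
      (fun i hi => if_neg (by omega)) (fun i hi => if_neg (by omega)) _ hgs hfs)
  obtain ⟨t, s', he, ht, s₁, hs₁, hsim⟩ := Runs.translate (m' := divMachine n bound) (s' := s)
    (φ := id) (sz := .size) (adr := id) e.injective le_rfl (fun _ _ _ _ h => h) (fun _ h => h)
    (fun _ h => h) (fun _ _ => rfl) (fun _ _ _ => rfl) hrun
  refine ⟨t, s', he, ht, fun i hi => ?_⟩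
  have h1 := hsim.mem (2 * n + i) (by simp only [divMachine]; omega)
  rw [id] at h1
  rw [h1, hs₁ i hi, hqe i hi]

end Division

/-! ### The choice of the constants -/

section Constants

/-- Rounding up Bk by a factor 1 + ε is harmless because c is smaller than B by the factor 1 - δ,
and (1 - δ)(1 + ε) ≤ 1. -/
theorem block_size_le {c δ ε B n k : ℝ} (hcB : c = (1 - δ) * B) (hδ : 0 < δ) (hδ1 : δ ≤ 1)
    (hεδ : ε ≤ δ / 4) (hε : 0 < ε) (hn : 0 ≤ n) (hk : B * k ≤ (1 + ε) * n) : c * k ≤ n := by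
  have h1 : (1 - δ) * (B * k) ≤ (1 - δ) * ((1 + ε) * n) :=
    mul_le_mul_of_nonneg_left hk (by linarith)
  have h2 : (1 - δ) * (1 + ε) ≤ 1 := by nlinarith
  have h3 := mul_le_mul_of_nonneg_right h2 hn
  rw [hcB]
  linarith

/-- Here Bk + ck = (2 - δ) Bk ≤ (2 - δ)(1 + ε) n ≤ (2 - δ/2) n, which leaves δn/2 registers for the
constant `d`. -/
theorem block_space_le {c δ ε B n k d : ℝ} (hcB : c = (1 - δ) * B) (hδ1 : δ ≤ 1)
    (hεδ : ε ≤ δ / 4) (hδ : 0 ≤ δ) (hn : 0 ≤ n) (hk : B * k ≤ (1 + ε) * n) (hd : d ≤ δ / 2 * n) :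
    B * k + c * k + d ≤ 2 * n := by
  have h1 : (2 - δ) * (B * k) ≤ (2 - δ) * ((1 + ε) * n) :=
    mul_le_mul_of_nonneg_left hk (by linarith)
  have h2 : (2 - δ) * (1 + ε) ≤ 2 - δ / 2 := by nlinarith
  have h3 := mul_le_mul_of_nonneg_right h2 hn
  subst hcB
  nlinarith

/-- Separate the Newton part, where k ≤ n/c, from the block part, where Bk ≤ (1 + ε) n and B - 1 ≤
c. The excess ε (λ_m c/2 + λ_s) is at most λ_m/4 + 1/4, hence at most λ_m/2 since λ_m ≥ 1. -/
theorem block_time_le {lam_m lam_s c ε B n k : ℝ} (hlm : 1 ≤ lam_m) (hls : 1 ≤ lam_s) (hc : 1 ≤ c)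
    (hBc : B - 1 ≤ c) (hB : 1 ≤ B) (hεs : ε * lam_s ≤ 1 / 4) (hεc : ε * c ≤ 1 / 2) (hε : 0 ≤ ε)
    (hn : 0 ≤ n) (hk : B * k ≤ (1 + ε) * n) (hck : c * k ≤ n) :
    k * (lam_m * (1 + B * (B - 1) / 2) + lam_s * (1 + B)) ≤
      n * (lam_m * ((c + 1) / 2 + 1 / c) + lam_s * (1 + 1 / c)) := by
  have h1 : k ≤ n * (1 / c) := by
    rw [mul_one_div, le_div_iff₀ (by linarith)]
    linarith
  have h2 : lam_m * ((B - 1) / 2) + lam_s ≤ lam_m * (c / 2) + lam_s := by nlinarith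
  have h3 : B * k * (lam_m * ((B - 1) / 2) + lam_s) ≤
      (1 + ε) * n * (lam_m * (c / 2) + lam_s) := by
    refine mul_le_mul hk h2 ?_ (by positivity)
    have : 0 ≤ (B - 1) / 2 := by linarith
    positivity
  have h4 : (1 + ε) * (lam_m * (c / 2) + lam_s) ≤ lam_m * ((c + 1) / 2) + lam_s := by
    have : ε * c * lam_m ≤ 1 / 2 * lam_m := mul_le_mul_of_nonneg_right hεc (by linarith)
    nlinarith
  have h5 := mul_le_mul_of_nonneg_left h4 hn
  have h6 := mul_le_mul_of_nonneg_right h1 (show (0 : ℝ) ≤ lam_m + lam_s by linarith)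
  nlinarith

/-- The summand 1 next to λ_m μ accounts for the coefficient subtractions. As A and B are constants,
these and the initial classical inversion cost O(n). The term 2Nn is reserved for classical division
in small sizes. -/
theorem total_time_le {lam_m lam_s A B N n k μ E : ℝ} (hB : 1 ≤ B) (hn : 1 ≤ n)
    (hkn : k ≤ n) (hN : 0 ≤ N)
    (hE : μ * (k * (lam_m * (1 + B * (B - 1) / 2) + lam_s * (1 + B))) ≤ E) :
    8 * A ^ 2 + ((lam_m * μ + 1) + lam_s * μ) * k +
        ((lam_m * μ + 1) * k * (B * (B - 1) / 2) + lam_s * μ * k * B) ≤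
      E + (2 * N + (8 * A ^ 2 + 2 + 2 * B ^ 2)) * n := by
  have h1 : k * (1 + B * (B - 1) / 2) ≤ n * (2 + 2 * B ^ 2) :=
    mul_le_mul hkn (by nlinarith) (by nlinarith) (by linarith)
  have h2 : 8 * A ^ 2 ≤ 8 * A ^ 2 * n := le_mul_of_one_le_right (by positivity) hn
  have h3 : 0 ≤ 2 * N * n := by positivity
  linarith

end Constants

/-! ### The complexity bound for erasing division -/

theorem mainTheorem3 {K : Type*} [CommRing K]
    (M : ℕ → ℝ)
    (hM : ∀ (α : ℝ) (n k : ℕ), 1 ≤ α → 1 ≤ n → (k : ℝ) = α * n → α * M n ≤ M k)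
    (lam_m lam_s c_m c_s c : ℝ)
    (hlm : 1 ≤ lam_m) (hls : 1 ≤ lam_s) (hcm : 0 ≤ c_m) (hcs : 0 ≤ c_s)
    (hc : c = max (c_m + 3) (c_s + 2))
    (MP SP : Algorithm K)
    (hMP : ComputesMiddleProduct MP (fun n => lam_m * M n))
    (hMP_space : ∃ d : ℝ, ∀ n : ℕ, 1 ≤ n → (MP.extraSpace n : ℝ) ≤ c_m * n + d)
    (hSP : ComputesShortProduct SP (fun n => lam_s * M n))
    (hSP_space : ∃ d : ℝ, ∀ n : ℕ, 1 ≤ n → (SP.extraSpace n : ℝ) ≤ c_s * n + d) :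
    ∃ (D : Algorithm K) (C : ℝ) (S : ℕ),
      ComputesErasingDivision D (fun n =>
        (lam_m * ((c + 1) / 2 + 1 / c) + lam_s * (1 + 1 / c)) * M n + C * n) ∧
      ∀ n : ℕ, 1 ≤ n → D.extraSpace n ≤ S := by
  obtain ⟨d₁, hd₁⟩ := hMP_space
  obtain ⟨d₂, hd₂⟩ := hSP_space
  have hcm3 : c_m + 3 ≤ c := hc ▸ le_max_left _ _
  have hcs2 : c_s + 2 ≤ c := hc ▸ le_max_right _ _
  have hc3 : 3 ≤ c := by linarith
  -- The number of operations of one middle product, here of zero polynomials, is at least 0 and at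
  -- most λ_m M(n).
  have hM0 : ∀ n, 1 ≤ n → 0 ≤ M n := by
    intro n hn
    obtain ⟨t, -, -, ht, -⟩ := hMP n hn 0 0 (by simp) (by simp) ⟨fun _ => 0, fun _ => .elem 0⟩
      (fun i _ => by simp) (fun i _ => by simp)
    have h1 : 0 ≤ lam_m * M n := t.cast_nonneg.trans ht
    exact nonneg_of_mul_nonneg_right h1 (by linarith)
  -- The floor plus one rather than the ceiling: B > c must be strict even for integral c, so that δ
  -- = 1 - c/B is positive.
  set B : ℕ := ⌊c⌋₊ + 1 with hB
  have hcB : c < B := by rw [hB]; exact_mod_cast Nat.lt_floor_add_one c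
  have hBc : (B : ℝ) - 1 ≤ c := by
    rw [hB]
    push_cast
    linarith [Nat.floor_le (show 0 ≤ c by linarith)]
  have hB2 : 2 ≤ B := by
    have : (2 : ℝ) ≤ B := by linarith
    exact_mod_cast this
  have hB0 : (0 : ℝ) < B := by linarith
  set δ : ℝ := 1 - c / B with hδ
  have hδ0 : 0 < δ := by rw [hδ, sub_pos, div_lt_one hB0]; exact hcB
  have hδ1 : δ ≤ 1 := by
    have : 0 ≤ c / B := by positivity
    linarith
  have hcδ : c = (1 - δ) * B := by rw [hδ]; field_simp; ring
  -- The three summands make ε = 1/A satisfy ελ_s ≤ 1/4, εc ≤ 1/2 and ε ≤ δ/4.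
  obtain ⟨A, hA⟩ := exists_nat_ge (4 * lam_s + 2 * c + 4 / δ)
  have hδ4 : 0 < 4 / δ := by positivity
  have hA0 : (0 : ℝ) < A := by linarith
  have hA1 : 1 ≤ A := by exact_mod_cast hA0
  set ε : ℝ := 1 / A with hε
  have hε0 : 0 < ε := by positivity
  have hεδ : ε ≤ δ / 4 := by
    rw [hε, div_le_iff₀ hA0]
    have : 4 / δ ≤ A := by linarith
    rw [div_le_iff₀ hδ0] at this
    linarith
  have hεs : ε * lam_s ≤ 1 / 4 := by
    rw [hε, one_div_mul_eq_div, div_le_iff₀ hA0]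
    linarith
  have hεc : ε * c ≤ 1 / 2 := by
    rw [hε, one_div_mul_eq_div, div_le_iff₀ hA0]
    linarith
  -- From this size on, the additive space constants of both algorithms are at most δn/2.
  obtain ⟨N₁, hN₁⟩ := exists_nat_ge (max d₁ d₂ / (δ / 2))
  set N := max N₁ (2 * A * B) with hN
  set coef := lam_m * ((c + 1) / 2 + 1 / c) + lam_s * (1 + 1 / c) with hcoef
  have hcoef0 : 0 ≤ coef := by positivity
  refine ⟨erasingDivision MP SP A B N, 2 * N + (8 * A ^ 2 + 2 + 2 * B ^ 2),
    MP.numIdx + SP.numIdx + 8 + 2, computesErasingDivision ?_ ?_, fun n _ => le_rfl⟩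
  · intro n hn hnN
    have h1 : ((2 * n ^ 2 : ℕ) : ℝ) ≤ 2 * N * n := by
      have : 2 * n ^ 2 ≤ 2 * N * n := by nlinarith
      exact_mod_cast this
    have h2 : (0 : ℝ) ≤ (8 * A ^ 2 + 2 + 2 * B ^ 2) * n := by positivity
    have h3 := mul_nonneg hcoef0 (hM0 n hn)
    linarith
  · intro n bound hn hNn hbound hbm hbs f g q v hu hq hv hg0 hf0 s hg hf
    have hn0 : (0 : ℝ) < n := by exact_mod_cast hn
    have hkr : ∀ k : ℕ, A * (B * k) ≤ (A + 1) * n → (B : ℝ) * k ≤ (1 + ε) * n := by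
      intro k hk
      have h1 : (A : ℝ) * (B * k) ≤ (A + 1) * n := by exact_mod_cast hk
      have h2 : (A : ℝ) * ((1 + ε) * n) = (A + 1) * n := by
        rw [hε]; field_simp
      rw [← h2] at h1
      exact le_of_mul_le_mul_left h1 hA0
    have hck : ∀ k : ℕ, A * (B * k) ≤ (A + 1) * n → c * k ≤ n := fun k hk =>
      block_size_le hcδ hδ0 hδ1 hεδ hε0 hn0.le (hkr k hk)
    have hdn : max d₁ d₂ ≤ δ / 2 * n := by
      rw [div_le_iff₀ (by positivity)] at hN₁
      have : (N₁ : ℝ) ≤ n := by exact_mod_cast (le_max_left _ _).trans hNn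
      nlinarith
    set μ : ℝ := M n / n with hμ
    have hμ0 : 0 ≤ μ := div_nonneg (hM0 n hn) hn0.le
    -- The growth hypothesis with α = n/h: every product of size h ≤ n is charged at the linear rate
    -- μ = M(n)/n.
    have hMh : ∀ h : ℕ, 1 ≤ h → h ≤ n → M h ≤ μ * h := by
      intro h hh hhn
      have hh0 : (0 : ℝ) < h := by exact_mod_cast hh
      have := hM (n / h) h n (by rw [one_le_div hh0]; exact_mod_cast hhn) hh (by field_simp)
      rw [hμ, div_mul_eq_mul_div, le_div_iff₀ hn0]
      rw [div_mul_eq_mul_div, div_le_iff₀ hh0] at this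
      linarith
    refine runs_blockDiv hMP hSP Sum.inl_injective Sum.inr_injective hA1 hB2
      ((le_max_right _ _).trans hNn) hbound hbm hbs (x := lam_m * μ + 1) (y := lam_s * μ)
      (by positivity) (by positivity) ?_ ?_ ?_ ?_ hu hq hv hg0 hf0 hg hf
    · intro h hh hhn
      have := mul_le_mul_of_nonneg_left (hMh h hh hhn) (show (0 : ℝ) ≤ lam_m by linarith)
      linarith
    · intro h hh hhn
      have := mul_le_mul_of_nonneg_left (hMh h hh hhn) (show (0 : ℝ) ≤ lam_s by linarith)
      linarith
    · intro k hk h hh hhk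
      have hsp := block_space_le (d := max d₁ d₂) hcδ hδ1 hεδ hδ0.le hn0.le (hkr k hk) hdn
      have hhk' : (h : ℝ) ≤ k := by exact_mod_cast hhk
      have hk0 : (0 : ℝ) ≤ k := k.cast_nonneg
      constructor
      · have h1 := hd₁ h hh
        have h2 : (MP.work h : ℝ) ≤ MP.extraSpace h := by
          exact_mod_cast Nat.le_add_left _ _
        have h3 : c_m * h ≤ c_m * k := mul_le_mul_of_nonneg_left hhk' hcm
        have h4 : (c_m + 3) * k ≤ c * k := mul_le_mul_of_nonneg_right hcm3 hk0
        have h5 := le_max_left d₁ d₂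
        -- The inverse, the product and the work space take at most k + h + c_m h + d, and k + h +
        -- c_m h ≤ ck.
        have : (n + B * k + k + h + MP.work h : ℝ) ≤ 3 * n := by linarith
        exact_mod_cast this
      · have h1 := hd₂ h hh
        have h2 : (SP.work h : ℝ) ≤ SP.extraSpace h := by
          exact_mod_cast Nat.le_add_left _ _
        have h3 : c_s * h ≤ c_s * k := mul_le_mul_of_nonneg_left hhk' hcs
        have h4 : (c_s + 2) * k ≤ c * k := mul_le_mul_of_nonneg_right hcs2 hk0
        have h5 := le_max_right d₁ d₂
        have : (n + B * k + k + h + SP.work h : ℝ) ≤ 3 * n := by linarith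
        exact_mod_cast this
    · intro k hk
      have hk0 : (0 : ℝ) ≤ k := k.cast_nonneg
      have ht := mul_le_mul_of_nonneg_left (block_time_le hlm hls (by linarith) hBc (by linarith)
        hεs hεc hε0.le hn0.le (hkr k hk) (hck k hk)) hμ0
      rw [← hcoef, ← mul_assoc μ n, hμ, div_mul_cancel₀ _ hn0.ne', ← hμ,
        mul_comm (M n)] at ht
      have hkn : (k : ℝ) ≤ n := by
        have := hck k hk
        nlinarith
      exact total_time_le (by linarith) (by exact_mod_cast hn) hkn (N.cast_nonneg) ht
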